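/- A qcb$_0$-space is a $T_0$ topological space that is a topological quotient of a countably based space; $\mathsf{QCB}_0$ is the category of all qcb$_0$-spaces and continuous functions. For spaces $X,Y$ let $Y^X$ be the set of continuous functions $X\to Y$ with the sequentialization of the compact-open topology, and for a family of spaces $(X_i)_{i\in I}$ let $\prod_{i\in I} X_i$ carry the sequentialization of the Tychonoff topology; here the sequentialization of a topology consists of the complements of the sets closed under limits of convergent sequences. Let $\omega$ be the discrete space of natural numbers, let $\mathbf 1$ be a one-point space, and define spaces $\mathbb N\langle\alpha\rangle$ for $\alpha<\omega_1$ by $$\mathbb N\langle 0\rangle:=\omega,\qquad \mathbb N\langle\alpha+1\rangle:=\omega^{\mathbb N\langle\alpha\rangle},\qquad \mathbb N\langle\lambda\rangle:=\prod_{\alpha<\lambda}\mathbb N\langle\alpha\rangle\ \text{ for limit ordinals } \lambda<\omega_1 .$$ A full subcategory $\mathsf P$ of $\mathsf{QCB}_0$ is called closed under countable $\mathsf{QCB}_0$-products if every countable family of $\mathsf P$-objects has a product in the category $\mathsf{QCB}_0$ that is a $\mathsf P$-object. (Products are determined up to homeomorphism. A category is cartesian closed if it has finite products and any two objects have an exponential.)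 Theorem. The spaces $\mathbf 1$ and $\mathbb N\langle\alpha\rangle$, $\alpha<\omega_1$, are qcb$_0$-spaces, and the full subcategory $\mathsf F:=\{\mathbf 1,\mathbb N\langle\alpha\rangle \mid \alpha<\omega_1\}$ of $\mathsf{QCB}_0$ is cartesian closed and closed under countable $\mathsf{QCB}_0$-products. Moreover, $\mathsf F$ is the smallest such subcategory in the following sense: if $\mathsf C$ is a full subcategory of $\mathsf{QCB}_0$ that is cartesian closed, is closed under countable $\mathsf{QCB}_0$-products and contains $\omega$ as an object, then every $\mathsf F$-object is homeomorphic to a $\mathsf C$-object. -/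

import Mathlib

open CategoryTheory CategoryTheory.Limits Filter
open scoped Topology Ordinal

namespace QCB

/-- The set `X`, to be endowed with the sequentialization of its given topology. -/
def Sequentialized (X : Type) : Type := X

/-- The identity map from `X` onto its sequentialization. -/
def toSeq (X : Type) : X ≃ Sequentialized X := Equiv.refl X

/-- The sequentialization of a topology: a set is open iff its complement is closed under
limits of convergent sequences of the original topology. -/
instance instSequentialized (X : Type) [TopologicalSpace X] :
    TopologicalSpace (Sequentialized X) where
  IsOpen s := IsSeqClosed (toSeq X ⁻¹' sᶜ)
  isOpen_univ := fun _ _ hx _ => absurd trivial (hx 0)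
  isOpen_inter s t hs ht := by
    intro x p hx hp ⟨hps, hpt⟩
    by_cases h : ∃ᶠ n in atTop, toSeq X (x n) ∉ s
    · obtain ⟨φ, hφ, hφs⟩ := extraction_of_frequently_atTop h
      exact hs (x := x ∘ φ) hφs (hp.comp hφ.tendsto_atTop) hps
    · rw [not_frequently, eventually_atTop] at h
      obtain ⟨N, hN⟩ := h
      refine ht (x := fun n => x (n + N)) (fun n hn => ?_)
        (hp.comp (tendsto_add_atTop_nat N)) hpt
      exact hx (n + N) ⟨not_not.1 (hN (n + N) (Nat.le_add_left N n)), hn⟩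
  isOpen_sUnion S hS := by
    rintro x p hx hp ⟨s, hsS, hps⟩
    exact hS s hsS (fun n hn => hx n ⟨s, hsS, hn⟩) hp hps

/-- The function space `Y ^ X`: all continuous maps from `X` to `Y`, with the sequentialization
of the compact-open topology. -/
def funSpace (X Y : TopCat.{0}) : TopCat.{0} :=
  TopCat.of (Sequentialized C(X, Y))

/-- The product of a family of spaces, with the sequentialization of the Tychonoff topology. -/
def seqProd {ι : Type} (X : ι → TopCat.{0}) : TopCat.{0} :=
  TopCat.of (Sequentialized (∀ i, X i))

/-- The space `ω` of natural numbers with the discrete topology. -/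
def omegaSpace : TopCat.{0} := TopCat.of ℕ

/-- The space `N⟨α⟩` of continuous functionals of type `α` over `ω`:
`N⟨0⟩ = ω`, `N⟨α + 1⟩ = ω ^ N⟨α⟩`, and `N⟨o⟩ = ∏_{α < o} N⟨α⟩` for a limit ordinal `o`.
(The small type `o.ToType` enumerates the ordinals below `o`.) -/
noncomputable def functionals (α : Ordinal.{0}) : TopCat.{0} :=
  Ordinal.limitRecOn (motive := fun _ => TopCat.{0}) α
    omegaSpace
    (fun _ N => funSpace N omegaSpace)
    (fun o _ N => seqProd (fun i : o.ToType => N i.toOrd.1 i.toOrd.2))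

/-- qcb₀-spaces: `T₀` topological quotients of countably based spaces. -/
def IsQCB0 : ObjectProperty TopCat.{0} := fun X =>
  T0Space X ∧ ∃ A : TopCat.{0}, SecondCountableTopology A ∧ ∃ q : A → X, Topology.IsQuotientMap q

/-- The category of qcb₀-spaces and all continuous maps. -/
abbrev QCB0 : Type 1 := IsQCB0.FullSubcategory

/-- A class `P` of spaces is closed under countable products of `QCB0`: every countable family
of qcb₀-spaces from `P` has a product, in the category `QCB0`, that belongs to `P`. -/
def ClosedUnderCountableProducts (P : ObjectProperty TopCat.{0}) : Prop :=
  ∀ (ι : Type) [Countable ι] (X : ι → QCB0), (∀ i, P (X i).obj) →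
    ∃ c : Fan X, P c.pt.obj ∧ Nonempty (IsLimit c)

/-- A category is cartesian closed: it has finite products, and all exponentials. -/
def IsCartesianClosed (C : Type 1) [Category.{0} C] : Prop :=
  ∃ _ : CartesianMonoidalCategory C, Nonempty (MonoidalClosed C)

/-- The class `F = {1, N⟨α⟩ : α < ω₁}`. -/
def F : ObjectProperty TopCat.{0} := fun X =>
  X = TopCat.of PUnit ∨ ∃ α : Ordinal.{0}, α < ω₁ ∧ X = functionals α

end QCB

/-! All spaces involved are sequential, hence determined up to homeomorphism by their convergent
sequences. On these, sequentialized products carry coordinatewise convergence and, for a sequential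
Hausdorff exponent, the function space carries continuous convergence (`tendsto_continuousMap_iff`).
The problem thus moves to sets with convergent sequences, where currying and products are formal.
There the engine is absorption: `Y` absorbs `X` if `X × Y ≅ Y`, and spaces that absorb each other
are isomorphic. The key case is an Eilenberg-style shift in `Absorbs.int_pow_of_retract`, using the
group structure of `ℤ ≅ ω`. It yields that `N⟨α⟩` absorbs `N⟨β⟩` for `β ≤ α` (`absorbs_limF`), and
that `N⟨α⟩` is its own countable power for `α ≠ 0` (`limF_pow`). So a countable product of the `N⟨a
i⟩` depends essentially on the supremum of the `a i` (`isLimF_pi_limF`), and `N⟨α + 1⟩ ^ N⟨β⟩ ≅ ω ^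
(N⟨β⟩ × N⟨α⟩) ≅ N⟨max α β + 1⟩`; limit exponentiation bases reduce to products. That the spaces are
qcb₀ follows because countable pseudobases survive both constructions and sequential `T₀` spaces
with one are quotients of countably based spaces. For minimality, a competing subcategory contains
the Baire space as a countable power of `ω`. Every convergent sequence is the image of one in the
Baire space, so the universal properties tested on that single object force the abstract products
and exponentials to have the expected convergent sequences (`exists_limEquiv_of_lift`). -/

namespace QCB

/-! ### Sets with convergent sequences -/

/-- A set with a notion of convergent sequence, such that constant sequences converge and
convergence only depends on the tails of a sequence. -/
class LimSpace (X : Type) where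
  Conv : (ℕ → X) → X → Prop
  conv_const : ∀ x, Conv (fun _ => x) x
  conv_congr : ∀ {u v : ℕ → X} {x : X}, u =ᶠ[atTop] v → Conv u x → Conv v x

open LimSpace

variable {X X' Y Y' Z R S : Type} [LimSpace X] [LimSpace X'] [LimSpace Y] [LimSpace Y']
  [LimSpace Z] [LimSpace R] [LimSpace S]

/-- The discrete convergence structure. -/
abbrev LimSpace.discrete (X : Type) : LimSpace X where
  Conv u x := ∀ᶠ n in atTop, u n = x
  conv_const _ := Eventually.of_forall fun _ => rfl
  conv_congr h hu := by filter_upwards [h, hu] with n h1 h2 using h1 ▸ h2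

/-- Only the eventually constant sequences converge. -/
class DiscreteLimSpace (D : Type) [LimSpace D] : Prop where
  conv_iff : ∀ {u : ℕ → D} {x : D}, Conv u x ↔ ∀ᶠ n in atTop, u n = x

open DiscreteLimSpace

instance : LimSpace ℕ := .discrete ℕ
instance : LimSpace ℤ := .discrete ℤ
instance : DiscreteLimSpace ℕ := ⟨Iff.rfl⟩
instance : DiscreteLimSpace ℤ := ⟨Iff.rfl⟩

instance : LimSpace Unit where
  Conv _ _ := True
  conv_const _ := trivial
  conv_congr _ _ := trivial

instance : LimSpace (X × Y) where
  Conv u x := Conv (fun n => (u n).1) x.1 ∧ Conv (fun n => (u n).2) x.2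
  conv_const x := ⟨conv_const x.1, conv_const x.2⟩
  conv_congr h hu := ⟨conv_congr (h.mono fun _ h => congrArg Prod.fst h) hu.1,
    conv_congr (h.mono fun _ h => congrArg Prod.snd h) hu.2⟩

instance {ι : Type} (X : ι → Type) [∀ i, LimSpace (X i)] : LimSpace (∀ i, X i) where
  Conv u x := ∀ i, Conv (fun n => u n i) (x i)
  conv_const x i := conv_const (x i)
  conv_congr h hu i := conv_congr (h.mono fun _ h => congrFun h i) (hu i)

/-- Maps preserving convergent sequences. -/
@[ext]
structure LimHom (X Y : Type) [LimSpace X] [LimSpace Y] where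
  toFun : X → Y
  map_conv' : ∀ {u : ℕ → X} {x : X}, Conv u x → Conv (fun n => toFun (u n)) (toFun x)

namespace LimHom

instance : FunLike (LimHom X Y) X Y where
  coe := toFun
  coe_injective f g h := by cases f; cases g; congr

theorem map_conv (f : LimHom X Y) {u : ℕ → X} {x : X} (h : Conv u x) :
    Conv (fun n => f (u n)) (f x) := f.map_conv' h

@[simp] theorem coe_mk (f : X → Y) (h) (x : X) : (⟨f, h⟩ : LimHom X Y) x = f x := rfl

theorem ext_apply {f g : LimHom X Y} (h : ∀ x, f x = g x) : f = g := DFunLike.ext _ _ h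

/-- Continuous convergence. -/
instance : LimSpace (LimHom X Y) where
  Conv F f := ∀ {u : ℕ → X} {x : X}, Conv u x → Conv (fun n => F n (u n)) (f x)
  conv_const f _ _ h := f.map_conv h
  conv_congr h hF _ _ hu := conv_congr (h.mono fun n hn => by simp only [hn]) (hF hu)

def comp (g : LimHom Y Z) (f : LimHom X Y) : LimHom X Z :=
  ⟨fun x => g (f x), fun h => g.map_conv (f.map_conv h)⟩

@[simp] theorem comp_apply (g : LimHom Y Z) (f : LimHom X Y) (x : X) : g.comp f x = g (f x) := rfl

def const (y : Y) : LimHom X Y := ⟨fun _ => y, fun _ => conv_const y⟩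

end LimHom

/-- Bijections preserving and reflecting convergent sequences. -/
structure LimEquiv (X Y : Type) [LimSpace X] [LimSpace Y] extends X ≃ Y where
  map_conv : ∀ {u : ℕ → X} {x : X}, Conv u x → Conv (fun n => toFun (u n)) (toFun x)
  symm_conv : ∀ {u : ℕ → Y} {y : Y}, Conv u y → Conv (fun n => invFun (u n)) (invFun y)

namespace LimEquiv

def refl (X : Type) [LimSpace X] : LimEquiv X X := ⟨Equiv.refl X, id, id⟩

def symm (e : LimEquiv X Y) : LimEquiv Y X := ⟨e.toEquiv.symm, e.symm_conv, e.map_conv⟩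

def trans (e : LimEquiv X Y) (f : LimEquiv Y Z) : LimEquiv X Z :=
  ⟨e.toEquiv.trans f.toEquiv, fun h => f.map_conv (e.map_conv h),
    fun h => e.symm_conv (f.symm_conv h)⟩

def hom (e : LimEquiv X Y) : LimHom X Y := ⟨e.toFun, e.map_conv⟩

def inv (e : LimEquiv X Y) : LimHom Y X := e.symm.hom

@[simp] theorem inv_hom (e : LimEquiv X Y) (x : X) : e.inv (e.hom x) = x := e.left_inv x

@[simp] theorem hom_inv (e : LimEquiv X Y) (y : Y) : e.hom (e.inv y) = y := e.right_inv y

/-- An equivalence from mutually inverse convergence preserving maps. -/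
def ofHoms (f : LimHom X Y) (g : LimHom Y X) (h : ∀ x, g (f x) = x) (k : ∀ y, f (g y) = y) :
    LimEquiv X Y := ⟨⟨f, g, h, k⟩, f.map_conv, g.map_conv⟩

end LimEquiv

/-- Two sets with convergent sequences are isomorphic. -/
def LimIso (X Y : Type) [LimSpace X] [LimSpace Y] : Prop := Nonempty (LimEquiv X Y)

namespace LimIso

theorem refl (X : Type) [LimSpace X] : LimIso X X := ⟨.refl X⟩

theorem symm (h : LimIso X Y) : LimIso Y X := h.map .symm

theorem trans (h : LimIso X Y) (k : LimIso Y Z) : LimIso X Z := ⟨h.some.trans k.some⟩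

theorem prod (h : LimIso X X') (k : LimIso Y Y') : LimIso (X × Y) (X' × Y') := by
  obtain ⟨e⟩ := h
  obtain ⟨f⟩ := k
  exact ⟨Equiv.prodCongr e.toEquiv f.toEquiv, fun h => ⟨e.map_conv h.1, f.map_conv h.2⟩,
    fun h => ⟨e.symm_conv h.1, f.symm_conv h.2⟩⟩

theorem prod_comm : LimIso (X × Y) (Y × X) :=
  ⟨Equiv.prodComm X Y, fun h => ⟨h.2, h.1⟩, fun h => ⟨h.2, h.1⟩⟩

theorem prod_assoc : LimIso ((X × Y) × Z) (X × Y × Z) :=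
  ⟨Equiv.prodAssoc X Y Z, fun h => ⟨h.1.1, h.1.2, h.2⟩, fun h => ⟨⟨h.1, h.2.1⟩, h.2.2⟩⟩

theorem unit_prod : LimIso (Unit × X) X :=
  ⟨Equiv.punitProd X, fun h => h.2, fun h => ⟨trivial, h⟩⟩

section Pi

variable {ι κ : Type} {A B : ι → Type} [∀ i, LimSpace (A i)] [∀ i, LimSpace (B i)]

theorem pi (h : ∀ i, LimIso (A i) (B i)) : LimIso (∀ i, A i) (∀ i, B i) := by
  let e i := (h i).some
  exact ⟨Equiv.piCongrRight fun i => (e i).toEquiv, fun h i => (e i).map_conv (h i),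
    fun h i => (e i).symm_conv (h i)⟩

theorem pi_reindex (e : κ ≃ ι) : LimIso (∀ i, A i) (∀ k, A (e k)) := by
  refine ⟨(Equiv.piCongrLeft A e).symm, fun h i => h _, fun {u y} h i => ?_⟩
  obtain ⟨k, rfl⟩ := e.surjective i
  have := h k
  simpa [Equiv.piCongrLeft_apply_apply] using this

theorem pi_subtype (p : ι → Prop) :
    LimIso (∀ i, A i) ((∀ i : {i // p i}, A i) × (∀ i : {i // ¬p i}, A i)) := by
  classical
  refine ⟨Equiv.piEquivPiSubtypeProd p A, fun h => ⟨fun i => h i, fun i => h i⟩,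
    fun {u y} h i => ?_⟩
  by_cases hi : p i
  · simpa [Equiv.piEquivPiSubtypeProd, hi] using h.1 ⟨i, hi⟩
  · simpa [Equiv.piEquivPiSubtypeProd, hi] using h.2 ⟨i, hi⟩

theorem pi_prod : LimIso (∀ i, A i × B i) ((∀ i, A i) × (∀ i, B i)) :=
  ⟨⟨fun f => (fun i => (f i).1, fun i => (f i).2), fun f i => (f.1 i, f.2 i),
    fun _ => rfl, fun _ => rfl⟩, fun h => ⟨fun i => (h i).1, fun i => (h i).2⟩,
    fun h i => ⟨h.1 i, h.2 i⟩⟩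

theorem pi_unique [Unique ι] : LimIso (ι → X) X :=
  ⟨Equiv.funUnique ι X, fun h => h default, fun h _ => h⟩

theorem pi_isEmpty [IsEmpty ι] : LimIso (∀ i, A i) Unit :=
  ⟨⟨fun _ => (), fun _ => isEmptyElim, fun _ => funext isEmptyElim, fun _ => rfl⟩,
    fun _ => trivial, fun _ => isEmptyElim⟩

theorem pi_unit : LimIso (ι → Unit) Unit :=
  ⟨⟨fun _ => (), fun _ _ => (), fun _ => rfl, fun _ => rfl⟩, fun _ => trivial,
    fun _ _ => trivial⟩

theorem pi_comm {A : ι → κ → Type} [∀ i k, LimSpace (A i k)] :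
    LimIso (∀ i k, A i k) (∀ k i, A i k) :=
  ⟨Equiv.piComm A, fun h k i => h i k, fun h i k => h k i⟩

theorem hom_pi : LimIso (LimHom X (∀ i, A i)) (∀ i, LimHom X (A i)) :=
  ⟨⟨fun f i => ⟨fun x => f x i, fun h => f.map_conv h i⟩,
    fun f => ⟨fun x i => f i x, fun h i => (f i).map_conv h⟩, fun _ => rfl, fun _ => rfl⟩,
    fun h i _ _ hu => h hu i, fun h _ _ hu i => h i hu⟩

end Pi

theorem hom (h : LimIso X X') (k : LimIso Y Y') : LimIso (LimHom X Y) (LimHom X' Y') := by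
  obtain ⟨e⟩ := h
  obtain ⟨f⟩ := k
  exact ⟨⟨fun g => f.hom.comp (g.comp e.inv), fun g => f.inv.comp (g.comp e.hom),
    fun g => LimHom.ext_apply fun x => by simp, fun g => LimHom.ext_apply fun x => by simp⟩,
    fun h _ _ hu => f.map_conv (h (e.symm_conv hu)),
    fun h _ _ hu => f.symm_conv (h (e.map_conv hu))⟩

theorem hom_curry : LimIso (LimHom (X × Y) Z) (LimHom X (LimHom Y Z)) :=
  ⟨⟨fun f => ⟨fun x => ⟨fun y => f (x, y), fun h => f.map_conv ⟨conv_const x, h⟩⟩,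
      fun h _ _ hu => f.map_conv ⟨h, hu⟩⟩,
    fun f => ⟨fun p => f p.1 p.2, fun h => f.map_conv h.1 h.2⟩, fun _ => rfl, fun _ => rfl⟩,
    fun h _ _ hu _ _ hv => h ⟨hu, hv⟩, fun h _ _ hu => h hu.1 hu.2⟩

theorem map_conv_of_discrete [DiscreteLimSpace X] (f : X → Y) {u : ℕ → X} {x : X}
    (h : Conv u x) : Conv (fun n => f (u n)) (f x) :=
  conv_congr (u := fun _ => f x) ((conv_iff.1 h).mono fun _ hn => (congrArg f hn).symm)
    (conv_const _)

theorem hom_of_discrete [DiscreteLimSpace X] : LimIso (LimHom X Y) (X → Y) :=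
  ⟨⟨fun f n => f n, fun f => ⟨f, map_conv_of_discrete f⟩, fun _ => rfl, fun _ => rfl⟩,
    fun h i => h (conv_const i), fun {F f} h u x hu =>
      conv_congr (u := fun n => F n x) ((conv_iff.1 hu).mono fun n hn => by subst hn; rfl) (h x)⟩

theorem hom_unit : LimIso (LimHom Unit X) X :=
  ⟨⟨fun f => f (), fun x => .const x, fun _ => rfl, fun _ => rfl⟩,
    fun h => h (conv_const ()), fun h _ _ _ => h⟩

theorem unit_hom : LimIso (LimHom X Unit) Unit :=
  ⟨⟨fun _ => (), fun _ => .const (), fun _ => rfl, fun _ => rfl⟩,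
    fun _ => trivial, fun _ _ _ _ => trivial⟩

theorem of_discrete [DiscreteLimSpace X] [DiscreteLimSpace Y] (e : X ≃ Y) : LimIso X Y :=
  ⟨e, fun h => map_conv_of_discrete e h, fun h => map_conv_of_discrete e.symm h⟩

instance [DiscreteLimSpace X] [DiscreteLimSpace Y] : DiscreteLimSpace (X × Y) where
  conv_iff := (and_congr conv_iff conv_iff).trans
    (eventually_and.symm.trans (eventually_congr (.of_forall fun _ => Prod.ext_iff.symm)))

instance {ι : Type} [Finite ι] (A : ι → Type) [∀ i, LimSpace (A i)]
    [∀ i, DiscreteLimSpace (A i)] : DiscreteLimSpace (∀ i, A i) where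
  conv_iff := (forall_congr' fun _ => conv_iff).trans
    (eventually_all.symm.trans (eventually_congr (.of_forall fun _ => funext_iff.symm)))

theorem nat_int : LimIso ℕ ℤ := of_discrete (Denumerable.eqv ℤ).symm

theorem nat_prod_nat : LimIso (ℕ × ℕ) ℕ := of_discrete Nat.pairEquiv

theorem pi_nat_finite {ι : Type} [Finite ι] [Nonempty ι] : LimIso (ι → ℕ) ℕ := by
  obtain ⟨e⟩ : Nonempty ((ι → ℕ) ≃ ℕ) := nonempty_equiv_of_countable
  exact of_discrete e

end LimIso

/-! ### Absorption -/

/-- `Y` absorbs `X` if `X × Y` is isomorphic to `Y`. -/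
def Absorbs (Y X : Type) [LimSpace X] [LimSpace Y] : Prop := LimIso (X × Y) Y

namespace Absorbs

theorem congr (hY : LimIso Y Y') (hX : LimIso X X') (h : Absorbs Y X) : Absorbs Y' X' :=
  (hX.symm.prod hY.symm).trans (h.trans hY)

/-- Both spaces are isomorphic to their product; this plays the role of a Cantor–Schröder–Bernstein
theorem throughout. -/
theorem limIso (h : Absorbs Y X) (k : Absorbs X Y) : LimIso X Y :=
  k.symm.trans (LimIso.prod_comm.trans h)

theorem prod_left (h : Absorbs Y X) : Absorbs (Y × Z) X :=
  LimIso.prod_assoc.symm.trans (h.prod (.refl Z))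

section Pi

variable {ι κ : Type} {A : ι → Type} {B : κ → Type} [∀ i, LimSpace (A i)] [∀ i, LimSpace (B i)]

theorem pi {A B : ι → Type} [∀ i, LimSpace (A i)] [∀ i, LimSpace (B i)]
    (h : ∀ i, Absorbs (B i) (A i)) : Absorbs (∀ i, B i) (∀ i, A i) :=
  LimIso.pi_prod.symm.trans (LimIso.pi h)

/-- The factors indexed by the range of `f` do the absorbing, coordinate by coordinate; the
remaining factors are carried along. -/
theorem pi_of_injective (f : ι → κ) (hf : f.Injective) (h : ∀ i, Absorbs (B (f i)) (A i)) :
    Absorbs (∀ k, B k) (∀ i, A i) := by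
  have h1 : LimIso (∀ k : {k // k ∈ Set.range f}, B k) (∀ i, B (f i)) :=
    LimIso.pi_reindex (A := fun k : {k // k ∈ Set.range f} => B k) (Equiv.ofInjective f hf)
  have h2 := (LimIso.pi_subtype (A := B) (· ∈ Set.range f)).trans (h1.prod (.refl _))
  exact (prod_left (pi h)).congr h2.symm (.refl _)

theorem pi_of_apply (k : κ) (h : Absorbs (B k) X) : Absorbs (∀ k, B k) X :=
  (pi_of_injective (A := fun _ : Unit => X) (fun _ => k) (fun _ _ _ => rfl) fun _ => h).congr
    (.refl _) .pi_unique

end Pi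

/-- Replacing the values of `f` on the image of a retract by those of `k`. -/
def twist (s : LimHom S R) (r : LimHom R S) (f : LimHom R ℤ) (k : LimHom S ℤ) : LimHom R ℤ :=
  ⟨fun x => f x - f (s (r x)) + k (r x), fun {u x} h => by
    refine conv_iff.2 ?_
    filter_upwards [conv_iff.1 (f.map_conv h), conv_iff.1 (f.map_conv (s.map_conv (r.map_conv h))),
      conv_iff.1 (k.map_conv (r.map_conv h))] with n h1 h2 h3
    rw [h1, h2, h3]⟩

theorem twist_conv (s : LimHom S R) (r : LimHom R S) {F : ℕ → LimHom R ℤ} {f : LimHom R ℤ}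
    {K : ℕ → LimHom S ℤ} {k : LimHom S ℤ} (hF : Conv F f) (hK : Conv K k) :
    Conv (fun n => twist s r (F n) (K n)) (twist s r f k) := by
  intro u x h
  refine conv_iff.2 ?_
  filter_upwards [conv_iff.1 (hF h), conv_iff.1 (hF (s.map_conv (r.map_conv h))),
    conv_iff.1 (hK (r.map_conv h))] with n h1 h2 h3
  simp only [twist, LimHom.coe_mk]
  rw [h1, h2, h3]

theorem comp_conv (s : LimHom S R) {F : ℕ → LimHom R Z} {f : LimHom R Z} (hF : Conv F f) :
    Conv (fun n => (F n).comp s) (f.comp s) :=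
  fun h => hF (s.map_conv h)

/-- Insertion of a first element, restricting the rest along `s`. -/
def shift (s : LimHom S R) (g : LimHom S ℤ) (f : ℕ → LimHom R ℤ) : ℕ → LimHom S ℤ
  | 0 => g
  | n + 1 => (f n).comp s

/-- If `S` is a retract of `R`, then the countable power of `ℤ ^ R` absorbs `ℤ ^ S`. -/
theorem int_pow_of_retract (s : LimHom S R) (r : LimHom R S) (h : ∀ x, r (s x) = x) :
    Absorbs (ℕ → LimHom R ℤ) (LimHom S ℤ) := by
  -- Via `f ↦ (f - f ∘ s ∘ r, f ∘ s)` the group `ℤ ^ R` splits as a complement times `ℤ ^ S`. The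
  -- complement parts of the sequence stay in place, while the `ℤ ^ S` parts move one place to the
  -- right and `g` enters at index `0`; the inverse moves them back.
  refine ⟨⟨fun p n => twist s r (p.2 n) (shift s p.1 p.2 n),
    fun q => ((q 0).comp s, fun n => twist s r (q n) ((q (n + 1)).comp s)), ?_, ?_⟩, ?_, ?_⟩
  · rintro ⟨g, f⟩
    refine Prod.ext (LimHom.ext_apply fun x => ?_) (funext fun n => LimHom.ext_apply fun x => ?_)
    · simp [twist, shift, h]
    · simp [twist, shift, h]
  · intro q
    funext n
    refine LimHom.ext_apply fun x => ?_
    cases n <;> simp [twist, shift, h]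
  · intro u p hp n
    refine twist_conv s r (hp.2 n) ?_
    cases n with
    | zero => exact hp.1
    | succ n => exact comp_conv s (hp.2 n)
  · intro u q hq
    exact ⟨comp_conv s (hq 0), fun n => twist_conv s r (hq n) (comp_conv s (hq (n + 1)))⟩

/-- Subtraction is needed only in the construction, so the result passes to `ℕ` along a bijection of
discrete spaces. -/
theorem nat_pow_of_retract (s : LimHom S R) (r : LimHom R S) (h : ∀ x, r (s x) = x) :
    Absorbs (ℕ → LimHom R ℕ) (LimHom S ℕ) :=
  (int_pow_of_retract s r h).congr (.pi fun _ => .hom (.refl R) LimIso.nat_int.symm)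
    (.hom (.refl S) LimIso.nat_int.symm)

end Absorbs

end QCB

/-! ### Topology: sequentialization, function spaces and countable pseudobases. -/

namespace QCB

open LimSpace DiscreteLimSpace

/-! ### Topological spaces as sets with convergent sequences -/

/-- The points of a topological space, with its convergent sequences. -/
def Lim (X : Type) : Type := X

instance (X : Type) [TopologicalSpace X] : LimSpace (Lim X) where
  Conv u x := @Tendsto ℕ X u atTop (@nhds X _ x)
  conv_const _ := tendsto_const_nhds (X := X)
  conv_congr h hu := @Tendsto.congr' ℕ X _ _ _ _ h hu

variable {X Y Z : Type} [TopologicalSpace X] [TopologicalSpace Y] [TopologicalSpace Z]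

theorem lim_conv_iff {u : ℕ → X} {x : X} :
    @Conv (Lim X) _ u x ↔ Tendsto u atTop (𝓝 x) := Iff.rfl

/-- A continuous map as a map preserving convergent sequences. -/
def limMap (f : X → Y) (hf : Continuous f) : LimHom (Lim X) (Lim Y) :=
  ⟨f, fun h => lim_conv_iff.2 ((hf.tendsto _).comp (lim_conv_iff.1 h))⟩

theorem LimHom.continuous [SequentialSpace X] (f : LimHom (Lim X) (Lim Y)) :
    Continuous (X := X) (Y := Y) f :=
  SeqContinuous.continuous fun _ _ h => lim_conv_iff.1 (f.map_conv (lim_conv_iff.2 h))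

/-- Sequential spaces with the same convergent sequences are homeomorphic. -/
def LimEquiv.toHomeomorph [SequentialSpace X] [SequentialSpace Y]
    (e : LimEquiv (Lim X) (Lim Y)) : X ≃ₜ Y where
  toEquiv := e.toEquiv
  continuous_toFun := e.hom.continuous
  continuous_invFun := e.inv.continuous

theorem _root_.Homeomorph.limIso (e : X ≃ₜ Y) : LimIso (Lim X) (Lim Y) :=
  ⟨.ofHoms (limMap e e.continuous) (limMap e.symm e.symm.continuous) e.left_inv e.right_inv⟩

instance [DiscreteTopology X] : DiscreteLimSpace (Lim X) where
  conv_iff := by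
    intro u x
    refine (lim_conv_iff (X := X)).trans ?_
    rw [nhds_discrete]
    exact tendsto_pure

theorem limIso_nat : LimIso (Lim ℕ) ℕ := LimIso.of_discrete (Equiv.refl ℕ)

theorem limIso_pi {ι : Type} (A : ι → Type) [∀ i, TopologicalSpace (A i)] :
    LimIso (Lim (∀ i, A i)) (∀ i, Lim (A i)) :=
  ⟨⟨Equiv.refl _, fun {u x} h => (tendsto_pi_nhds (A := A) (f := u) (g := x)).1 h,
    fun {u x} h => (tendsto_pi_nhds (A := A) (f := u) (g := x)).2 h⟩⟩

/-! ### Sequentialization -/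

theorem continuous_toSeq_symm : Continuous (toSeq X).symm :=
  ⟨fun _ hs => hs.isClosed_compl.isSeqClosed⟩

/-- Sequentializing creates no new convergent sequences and destroys none: a sequence that is
frequently outside a sequentially open set has a subsequence in the complement, which then contains
the limit. -/
theorem tendsto_toSeq {u : ℕ → X} {x : X} :
    Tendsto (fun n => toSeq X (u n)) atTop (𝓝 (toSeq X x)) ↔ Tendsto u atTop (𝓝 x) := by
  refine ⟨fun h => (continuous_toSeq_symm.tendsto _).comp h, fun h => ?_⟩
  refine tendsto_nhds.2 fun s hs hx => ?_
  by_contra hu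
  obtain ⟨φ, hφ, hφs⟩ := extraction_of_frequently_atTop (not_eventually.1 hu)
  exact hs (x := u ∘ φ) hφs (h.comp hφ.tendsto_atTop) hx

instance : SequentialSpace (Sequentialized X) where
  isClosed_of_seq s hs := by
    refine ⟨fun u x hu hx => ?_⟩
    have hu' : ∀ n, toSeq X (u n) ∈ s := fun n => not_not.1 (hu n)
    exact not_not.2 (hs hu' (tendsto_toSeq.2 hx))

theorem limIso_sequentialized : LimIso (Lim (Sequentialized X)) (Lim X) :=
  ⟨⟨(toSeq X).symm, fun {u x} h => (tendsto_toSeq (X := X) (u := u) (x := x)).1 h,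
    fun {u x} h => (tendsto_toSeq (X := X) (u := u) (x := x)).2 h⟩⟩

instance [T2Space X] : T2Space (Sequentialized X) :=
  .of_injective_continuous (toSeq X).symm.injective continuous_toSeq_symm

/-! ### Function spaces -/

theorem tendsto_subseq_of_isCompact [SequentialSpace X] [T2Space X] {K : Set X}
    (hK : IsCompact K) {u : ℕ → X} (hu : ∀ n, u n ∈ K) :
    ∃ x ∈ K, ∃ φ : ℕ → ℕ, StrictMono φ ∧ Tendsto (u ∘ φ) atTop (𝓝 x) := by
  by_cases h : ∃ x, ∃ φ : ℕ → ℕ, StrictMono φ ∧ Tendsto (u ∘ φ) atTop (𝓝 x)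
  · obtain ⟨x, φ, hφ, hx⟩ := h
    exact ⟨x, hK.isClosed.mem_of_tendsto hx (.of_forall fun _ => hu _), φ, hφ, hx⟩
  · push Not at h
    -- Without convergent subsequences all tails are closed, so by compactness they share a point.
    -- That point is a value taken infinitely often, which gives a constant subsequence after all.
    have hC : ∀ N, IsClosed (Set.range fun n => u (n + N)) := fun N =>
      isClosed_range_of_not_tendsto fun l φ hφ =>
        h l (fun n => φ n + N) fun _ _ hab => Nat.add_lt_add_right (hφ hab) N
    obtain ⟨p, hp⟩ := IsCompact.nonempty_iInter_of_sequence_nonempty_isCompact_isClosed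
      (fun N => Set.range fun n => u (n + N))
      (fun N => by
        rintro _ ⟨n, rfl⟩
        exact ⟨n + 1, congrArg u (by ring)⟩)
      (fun N => ⟨_, 0, rfl⟩)
      (hK.of_isClosed_subset (hC 0) (by rintro _ ⟨n, rfl⟩; exact hu _)) hC
    have hfreq : ∃ᶠ n in atTop, u n = p := frequently_atTop.2 fun N => by
      obtain ⟨n, hn⟩ := Set.mem_iInter.1 hp N
      exact ⟨n + N, Nat.le_add_left N n, hn⟩
    obtain ⟨φ, hφ, hφp⟩ := extraction_of_frequently_atTop hfreq
    exact absurd (tendsto_const_nhds.congr fun n => (hφp n).symm) (h p φ hφ)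

/-- Continuous convergence speaks of sequences indexed by all of `ℕ`; points chosen along a
subsequence are completed by filling the gaps with the limit. -/
theorem tendsto_extend {σ : ℕ → ℕ} (hσ : StrictMono σ) {b : ℕ → X} {x : X}
    (hb : Tendsto b atTop (𝓝 x)) :
    Tendsto (Function.extend σ b fun _ => x) atTop (𝓝 x) := by
  refine tendsto_nhds.2 fun U hU hx => ?_
  obtain ⟨N, hN⟩ := eventually_atTop.1 (hb.eventually (hU.mem_nhds hx))
  filter_upwards [eventually_ge_atTop (σ N)] with n hn
  by_cases h : ∃ j, σ j = n
  · obtain ⟨j, rfl⟩ := h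
    change Function.extend σ b _ (σ j) ∈ U
    rw [hσ.injective.extend_apply]
    exact hN j (hσ.le_iff_le.1 hn)
  · simpa [Function.extend_apply' _ _ _ h] using hx

/-- Convergence in the compact-open topology is continuous convergence. -/
theorem tendsto_continuousMap_iff [SequentialSpace X] [T2Space X] {F : ℕ → C(X, Y)} {f : C(X, Y)} :
    Tendsto F atTop (𝓝 f) ↔ ∀ (u : ℕ → X) (x : X), Tendsto u atTop (𝓝 x) →
      Tendsto (fun n => F n (u n)) atTop (𝓝 (f x)) := by
  constructor
  · intro hF u x hu
    refine tendsto_nhds.2 fun U hU hxU => ?_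
    obtain ⟨N, hN⟩ := eventually_atTop.1 (hu.eventually ((hU.preimage f.continuous).mem_nhds hxU))
    have hK : IsCompact (insert x (Set.range fun n => u (n + N))) :=
      ((tendsto_add_atTop_iff_nat N).2 hu).isCompact_insert_range
    have hfK : Set.MapsTo f (insert x (Set.range fun n => u (n + N))) U := by
      rintro _ (rfl | ⟨n, rfl⟩)
      exacts [hxU, hN _ (Nat.le_add_left N n)]
    filter_upwards [hF.eventually (ContinuousMap.eventually_mapsTo hK hU hfK),
      eventually_ge_atTop N] with n hn hNn
    exact hn (.inr ⟨n - N, by simp [Nat.sub_add_cancel hNn]⟩)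
  · intro h
    refine ContinuousMap.tendsto_nhds_compactOpen.2 fun K hK U hU hf => ?_
    by_contra hF
    obtain ⟨φ, hφ, hφK⟩ := extraction_of_frequently_atTop (not_eventually.1 hF)
    unfold Set.MapsTo at hφK
    push Not at hφK
    choose a haK haU using hφK
    obtain ⟨x, hxK, ψ, hψ, hx⟩ := tendsto_subseq_of_isCompact hK haK
    have hσ := hφ.comp hψ
    have hlim := (h _ x (tendsto_extend hσ hx)).comp hσ.tendsto_atTop
    obtain ⟨n, hn⟩ := (hlim.eventually (hU.mem_nhds (hf hxK))).exists
    rw [Function.comp_apply, hσ.injective.extend_apply] at hn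
    exact haU _ hn

theorem limIso_continuousMap [SequentialSpace X] [T2Space X] :
    LimIso (Lim C(X, Y)) (LimHom (Lim X) (Lim Y)) := by
  refine ⟨⟨⟨fun f => limMap (ContinuousMap.toFun f) (ContinuousMap.continuous_toFun f),
    fun f => (⟨f, f.continuous⟩ : C(X, Y)), fun _ => rfl, fun _ => rfl⟩, ?_, ?_⟩⟩
  · intro F f h u x hu
    exact tendsto_continuousMap_iff.1 (lim_conv_iff.1 h) u x hu
  · intro F f h
    exact tendsto_continuousMap_iff.2 fun u x hu => h (lim_conv_iff.2 hu)

/-! ### Countable pseudobases -/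

/-- A countable family of sets such that every sequence which is eventually in all the members
containing `x` and eventually `u`, for some sequence `u` converging to `x`, converges to `x`. -/
structure IsPseudoSubbase {κ : Type} (B : κ → Set X) : Prop where
  tendsto : ∀ {u : ℕ → X} {x : X}, Tendsto u atTop (𝓝 x) → ∀ {a : ℕ → X},
    (∀ k, x ∈ B k → (∀ᶠ n in atTop, u n ∈ B k) → ∀ᶠ n in atTop, a n ∈ B k) →
    Tendsto a atTop (𝓝 x)

/-- Having a countable pseudobase. -/
def HasPseudobase (X : Type) [TopologicalSpace X] : Prop :=
  ∃ (κ : Type) (_ : Countable κ) (B : κ → Set X), IsPseudoSubbase B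

namespace IsPseudoSubbase

variable {κ : Type} {B : κ → Set X} {u : ℕ → X} {x : X}

theorem exists_seq [Countable κ] (hB : IsPseudoSubbase B) (hu : Tendsto u atTop (𝓝 x)) :
    ∃ K : ℕ → Finset κ, (∀ n, ∀ k ∈ K n, x ∈ B k ∧ ∀ᶠ m in atTop, u m ∈ B k) ∧
      ∀ a : ℕ → X, (∀ n, ∀ k ∈ K n, a n ∈ B k) → Tendsto a atTop (𝓝 x) := by
  obtain ⟨e, he⟩ := exists_injective_nat κ
  have hfin : ∀ n, {k | e k < n ∧ x ∈ B k ∧ ∀ᶠ m in atTop, u m ∈ B k}.Finite := fun n =>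
    ((Set.finite_lt_nat n).preimage he.injOn).subset fun k hk => hk.1
  refine ⟨fun n => (hfin n).toFinset, fun n k hk => ((hfin n).mem_toFinset.1 hk).2,
    fun a ha => hB.tendsto hu fun k hx hk => ?_⟩
  filter_upwards [eventually_gt_atTop (e k)] with n hn
  exact ha n k ((hfin n).mem_toFinset.2 ⟨hn, hx, hk⟩)

theorem exists_finset [Countable κ] (hB : IsPseudoSubbase B) (hu : Tendsto u atTop (𝓝 x))
    {U : Set X} (hU : IsOpen U) (hx : x ∈ U) :
    ∃ K : Finset κ, (∀ k ∈ K, x ∈ B k ∧ ∀ᶠ m in atTop, u m ∈ B k) ∧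
      ∀ y, (∀ k ∈ K, y ∈ B k) → y ∈ U := by
  obtain ⟨K, hK, hlim⟩ := hB.exists_seq hu
  by_contra! h
  choose a ha haU using fun n => h (K n) (hK n)
  obtain ⟨n, hn⟩ := ((hlim a ha).eventually (hU.mem_nhds hx)).exists
  exact haU n hn

end IsPseudoSubbase

theorem HasPseudobase.sequentialized (h : HasPseudobase X) : HasPseudobase (Sequentialized X) := by
  obtain ⟨κ, hκ, B, hB⟩ := h
  refine ⟨κ, hκ, fun k => (toSeq X).symm ⁻¹' B k, ⟨fun {u x} hu {a} ha => ?_⟩⟩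
  exact (tendsto_toSeq (X := X)).2 (hB.tendsto ((continuous_toSeq_symm.tendsto _).comp hu) ha)

theorem HasPseudobase.of_countable_discrete [Countable X] [DiscreteTopology X] :
    HasPseudobase X := by
  refine ⟨X, inferInstance, fun x => {x}, ⟨fun {u x} hu {a} ha => ?_⟩⟩
  rw [nhds_discrete, tendsto_pure] at hu ⊢
  exact ha x rfl hu

theorem HasPseudobase.pi {ι : Type} [Countable ι] {A : ι → Type} [∀ i, TopologicalSpace (A i)]
    (h : ∀ i, HasPseudobase (A i)) : HasPseudobase (∀ i, A i) := by
  choose κ hκ B hB using h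
  refine ⟨Σ i, κ i, inferInstance, fun k => {x | x k.1 ∈ B k.1 k.2},
    ⟨fun {u x} hu {a} ha => tendsto_pi_nhds.2 fun i => ?_⟩⟩
  exact (hB i).tendsto (tendsto_pi_nhds.1 hu i) fun k => ha ⟨i, k⟩

theorem HasPseudobase.continuousMap [SequentialSpace X] [T2Space X] [Countable Y]
    [DiscreteTopology Y] (h : HasPseudobase X) : HasPseudobase C(X, Y) := by
  obtain ⟨κ, hκ, B, hB⟩ := h
  -- The members are the sets of functions with a given constant value on a given finite
  -- intersection of pseudobase sets.
  refine ⟨Finset κ × Y, inferInstance, fun p => {f | ∀ b, (∀ k ∈ p.1, b ∈ B k) → f b = p.2},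
    ⟨fun {F f} hF {G} hG => tendsto_continuousMap_iff.2 fun u x hu => ?_⟩⟩
  obtain ⟨K, hK, hlim⟩ := hB.exists_seq hu
  -- Otherwise counterexamples chosen in the `n`-th intersections along a subsequence of `F` would
  -- converge to `x`, against continuous convergence.
  obtain ⟨n, hn⟩ : ∃ n, ∀ᶠ m in atTop, ∀ b, (∀ k ∈ K n, b ∈ B k) → F m b = f x := by
    by_contra! h
    obtain ⟨φ, hφ, hφb⟩ := extraction_forall_of_frequently h
    choose b hb hbx using hφb
    have := tendsto_continuousMap_iff.1 (hF.comp hφ.tendsto_atTop) b x (hlim b hb)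
    rw [nhds_discrete, tendsto_pure] at this
    obtain ⟨n, hn⟩ := this.exists
    exact hbx n hn
  have hf : ∀ b, (∀ k ∈ K n, b ∈ B k) → f b = f x := fun b hb => by
    have := tendsto_continuousMap_iff.1 hF (fun _ => b) b tendsto_const_nhds
    rw [nhds_discrete, tendsto_pure] at this
    obtain ⟨m, h1, h2⟩ := (this.and hn).exists
    exact h1.symm.trans (h2 b hb)
  rw [nhds_discrete, tendsto_pure]
  filter_upwards [hG (K n, f x) hf hn,
    (K n).eventually_all.2 fun k hk => (hK n k hk).2] with m h1 h2
  exact h1 _ h2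

/-- Sequential `T₀` spaces with a countable pseudobase are qcb₀-spaces. -/
theorem isQCB0_of_hasPseudobase (X : TopCat.{0}) [SequentialSpace X] [T0Space X]
    (h : HasPseudobase X) : IsQCB0 X := by
  obtain ⟨κ, hκ, B, hB⟩ := h
  -- A point of the countably based space is a point of `X` together with a set of indices whose
  -- finite intersections contain the point and refine its open neighbourhoods. The topology sees
  -- only the indices.
  let A : Type := {p : X × Set κ // (∀ k ∈ p.2, p.1 ∈ B k) ∧ ∀ U : Set X, IsOpen U → p.1 ∈ U →
    ∃ K : Finset κ, ↑K ⊆ p.2 ∧ ∀ y, (∀ k ∈ K, y ∈ B k) → y ∈ U}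
  let _ : TopologicalSpace A := .generateFrom (Set.range fun k => {p : A | k ∈ p.1.2})
  have hA : SecondCountableTopology A := ⟨_, Set.countable_range _, rfl⟩
  have hopen : ∀ k, IsOpen {p : A | k ∈ p.1.2} := fun k => .basic _ ⟨k, rfl⟩
  let q : A → X := fun p => p.1.1
  have hmk : ∀ (u : ℕ → X) (x : X), Tendsto u atTop (𝓝 x) →
      ∃ p : A, p.1 = (x, {k | x ∈ B k ∧ ∀ᶠ n in atTop, u n ∈ B k}) := fun u x hu => by
    refine ⟨⟨(x, {k | x ∈ B k ∧ ∀ᶠ n in atTop, u n ∈ B k}), fun k hk => hk.1,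
      fun U hU hx => ?_⟩, rfl⟩
    obtain ⟨K, hK, hKU⟩ := hB.exists_finset hu hU hx
    exact ⟨K, fun k hk => hK k hk, hKU⟩
  refine ⟨inferInstance, TopCat.of A, hA, q,
    (Topology.isQuotientMap_iff _).2 ⟨Topology.isCoinducing_iff.2 fun V => Iff.symm ⟨?_, ?_⟩,
      fun x => ?_⟩⟩
  rotate_left 2
  · obtain ⟨p, hp⟩ := hmk (fun _ => x) x tendsto_const_nhds
    exact ⟨p, congrArg Prod.fst hp⟩
  · intro hV
    refine isOpen_iff_forall_mem_open.2 fun p hp => ?_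
    obtain ⟨K, hKp, hKV⟩ := p.2.2 V hV hp
    refine ⟨⋂ k ∈ K, {p : A | k ∈ p.1.2}, fun r hr => hKV _ fun k hk => r.2.1 k ?_,
      isOpen_biInter_finset fun k _ => hopen k, Set.mem_iInter₂.2 fun k hk => hKp hk⟩
    exact Set.mem_iInter₂.1 hr k hk
  · intro hV
    rw [← isClosed_compl_iff, ← isSeqClosed_iff_isClosed]
    intro u x hu hx hxV
    -- The convergent sequence is lifted: over `x` only those indices are kept whose sets eventually
    -- contain `u`, over `u n` all those whose sets contain `u n`.
    obtain ⟨p, hp⟩ := hmk u x hx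
    choose r hr using fun n => hmk (fun _ => u n) (u n) tendsto_const_nhds
    have hlim : Tendsto r atTop (𝓝 p) := by
      refine TopologicalSpace.tendsto_nhds_generateFrom_iff.2 ?_
      rintro _ ⟨k, rfl⟩ hk
      have hk' : k ∈ p.1.2 := hk
      rw [hp] at hk'
      filter_upwards [hk'.2] with n hn
      change k ∈ (r n).1.2
      rw [hr n]
      exact ⟨hn, .of_forall fun _ => hn⟩
    have hpV : p ∈ q ⁻¹' V := by
      change p.1.1 ∈ V
      rwa [hp]
    obtain ⟨n, hn⟩ := (hlim.eventually (hV.mem_nhds hpV)).exists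
    refine hu n ?_
    have : (r n).1.1 ∈ V := hn
    rwa [hr n] at this

theorem IsQCB0.sequentialSpace {X : TopCat.{0}} (h : IsQCB0 X) : SequentialSpace X := by
  obtain ⟨_, A, hA, q, hq⟩ := h
  exact hq.sequentialSpace

end QCB

/-! ### The hierarchy `N⟨α⟩`: absorption, countable products and function spaces up to isomorphism.
-/

namespace QCB

open LimSpace

/-! ### The spaces of functionals -/

theorem functionals_zero : functionals 0 = omegaSpace :=
  Ordinal.limitRecOn_zero _ _ _

theorem functionals_add_one (α : Ordinal.{0}) :
    functionals (α + 1) = funSpace (functionals α) omegaSpace :=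
  Ordinal.limitRecOn_add_one _ _ _ _

theorem functionals_limit {α : Ordinal.{0}} (h : Order.IsSuccLimit α) :
    functionals α = seqProd fun i : α.ToType => functionals i.toOrd.1 :=
  Ordinal.limitRecOn_limit _ _ _ _ h

theorem countable_toType {α : Ordinal.{0}} (h : α < ω₁) : Countable α.ToType := by
  rw [← Cardinal.mk_le_aleph0_iff, Cardinal.mk_toType, ← Cardinal.lt_aleph_one_iff,
    ← Cardinal.lt_ord, Cardinal.ord_aleph]
  exact h

theorem add_one_lt_omega_one {α : Ordinal.{0}} (h : α < ω₁) : α + 1 < ω₁ :=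
  (Cardinal.isSuccLimit_omega 1).add_one_lt h

theorem toOrd_lt {α : Ordinal.{0}} (i : α.ToType) : i.toOrd.1 < α := Set.mem_Iio.1 i.toOrd.2

theorem toOrd_mk {α β : Ordinal.{0}} (h : β ∈ Set.Iio α) :
    (Ordinal.ToType.mk ⟨β, h⟩).toOrd.1 = β :=
  congrArg Subtype.val (Ordinal.ToType.mk.symm_apply_apply ⟨β, h⟩)

theorem toOrd_lt_omega_one {α : Ordinal.{0}} (h : α < ω₁) (i : α.ToType) : i.toOrd.1 < ω₁ :=
  lt_trans (toOrd_lt i) h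

/-- Sequential Hausdorff spaces with a countable pseudobase. -/
structure IsSeqPseudobased (X : TopCat.{0}) : Prop where
  sequential : SequentialSpace X
  t2 : T2Space X
  hasPseudobase : HasPseudobase X

namespace IsSeqPseudobased

theorem isQCB0 {X : TopCat.{0}} (h : IsSeqPseudobased X) : IsQCB0 X :=
  have := h.sequential
  have := h.t2
  isQCB0_of_hasPseudobase X h.hasPseudobase

theorem omegaSpace : IsSeqPseudobased omegaSpace where
  sequential := inferInstanceAs (SequentialSpace ℕ)
  t2 := inferInstanceAs (T2Space ℕ)
  hasPseudobase := HasPseudobase.of_countable_discrete (X := ℕ)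

theorem punit : IsSeqPseudobased (TopCat.of PUnit) where
  sequential := inferInstanceAs (SequentialSpace PUnit)
  t2 := inferInstanceAs (T2Space PUnit)
  hasPseudobase := HasPseudobase.of_countable_discrete (X := PUnit)

theorem funSpace {X : TopCat.{0}} (h : IsSeqPseudobased X) :
    IsSeqPseudobased (funSpace X QCB.omegaSpace) where
  sequential := inferInstanceAs (SequentialSpace (Sequentialized C(X, ℕ)))
  t2 := inferInstanceAs (T2Space (Sequentialized C(X, ℕ)))
  hasPseudobase :=
    have := h.sequential
    have := h.t2
    (HasPseudobase.continuousMap (Y := ℕ) h.hasPseudobase).sequentialized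

theorem seqProd {ι : Type} [Countable ι] {X : ι → TopCat.{0}} (h : ∀ i, IsSeqPseudobased (X i)) :
    IsSeqPseudobased (seqProd X) where
  sequential := inferInstanceAs (SequentialSpace (Sequentialized (∀ i, X i)))
  t2 :=
    have := fun i => (h i).t2
    inferInstanceAs (T2Space (Sequentialized (∀ i, X i)))
  hasPseudobase := (HasPseudobase.pi fun i => (h i).hasPseudobase).sequentialized

theorem functionals (α : Ordinal.{0}) (h : α < ω₁) : IsSeqPseudobased (functionals α) := by
  induction α using Ordinal.limitRecOn with
  | zero => exact functionals_zero ▸ omegaSpace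
  | add_one α ih =>
    rw [functionals_add_one]
    exact funSpace (ih ((lt_add_one α).trans h))
  | limit α hα ih =>
    rw [functionals_limit hα]
    have := countable_toType h
    exact seqProd fun i => ih _ (toOrd_lt i) (toOrd_lt_omega_one h i)

end IsSeqPseudobased

theorem F_isSeqPseudobased {X : TopCat.{0}} (h : F X) : IsSeqPseudobased X := by
  obtain rfl | ⟨α, hα, rfl⟩ := h
  exacts [.punit, .functionals α hα]

theorem F_le_isQCB0 : F ≤ IsQCB0 := fun _ h => (F_isSeqPseudobased h).isQCB0

theorem limIso_punit : LimIso (Lim PUnit) Unit :=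
  ⟨⟨Equiv.refl _, fun _ => trivial, fun {_ x} _ => conv_const (X := Lim PUnit) x⟩⟩

/-- The points and convergent sequences of `N⟨α⟩`. -/
abbrev LimF (α : Ordinal.{0}) : Type := Lim (functionals α)

theorem limIso_of_eq {X Y : TopCat.{0}} (h : X = Y) : LimIso (Lim X) (Lim Y) := h ▸ .refl _

theorem limF_zero : LimIso (LimF 0) ℕ :=
  (limIso_of_eq functionals_zero).trans limIso_nat

theorem limF_add_one {α : Ordinal.{0}} (h : α < ω₁) :
    LimIso (LimF (α + 1)) (LimHom (LimF α) ℕ) :=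
  have := (IsSeqPseudobased.functionals α h).sequential
  have := (IsSeqPseudobased.functionals α h).t2
  (limIso_of_eq (functionals_add_one α)).trans
    ((limIso_sequentialized (X := C(functionals α, ℕ))).trans
      (limIso_continuousMap.trans (.hom (.refl _) limIso_nat)))

theorem limIso_seqProd {ι : Type} (X : ι → TopCat.{0}) :
    LimIso (Lim (seqProd X)) (∀ i, Lim (X i)) :=
  (limIso_sequentialized (X := ∀ i, X i)).trans (limIso_pi _)

theorem limF_limit {α : Ordinal.{0}} (h : Order.IsSuccLimit α) :
    LimIso (LimF α) (∀ i : α.ToType, LimF i.toOrd.1) :=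
  (limIso_of_eq (functionals_limit h)).trans (limIso_seqProd _)

theorem nonempty_limF (α : Ordinal.{0}) : Nonempty (LimF α) := by
  induction α using Ordinal.limitRecOn with
  | zero => exact ⟨(limIso_of_eq functionals_zero).some.inv (0 : ℕ)⟩
  | add_one α ih =>
    rw [LimF, functionals_add_one]
    exact ⟨toSeq _ (ContinuousMap.const _ (0 : ℕ))⟩
  | limit α hα ih =>
    rw [LimF, functionals_limit hα]
    exact ⟨toSeq _ fun i => (ih _ (toOrd_lt i)).some⟩

/-! ### Absorption among the spaces of functionals -/

/-- Currying: `ω ^ N⟨α⟩ ≅ ω ^ (ω × N⟨α⟩) ≅ (ω ^ N⟨α⟩) ^ ω`. -/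
theorem limF_add_one_pow {α : Ordinal.{0}} (h : α < ω₁) (h0 : Absorbs (LimF α) (LimF 0)) :
    LimIso (LimF (α + 1)) (ℕ → LimF (α + 1)) := by
  have h1 : LimIso (ℕ × LimF α) (LimF α) := h0.congr (.refl _) limF_zero
  exact (limF_add_one h).trans ((LimIso.hom h1.symm (.refl ℕ)).trans
    (LimIso.hom_curry.trans (LimIso.hom_of_discrete.trans (.pi fun _ => (limF_add_one h).symm))))

theorem absorbs_limF {α β : Ordinal.{0}} (hα : α < ω₁) (hβ : β ≤ α) :
    Absorbs (LimF α) (LimF β) := by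
  induction α using Ordinal.limitRecOn generalizing β with
  | zero =>
    obtain rfl : β = 0 := le_antisymm hβ zero_le
    exact Absorbs.congr limF_zero.symm limF_zero.symm LimIso.nat_prod_nat
  | add_one α ih =>
    have hα' : α < ω₁ := (lt_add_one α).trans hα
    have hpow := limF_add_one_pow hα' (ih hα' zero_le)
    have hpow' := (LimIso.pi fun _ : ℕ => limF_add_one hα').symm.trans hpow.symm
    induction β using Ordinal.limitRecOn with
    | zero =>
      -- A point is a retract of any nonempty space, and `ω ^ 1 ≅ ω`.
      have hu := Absorbs.nat_pow_of_retract (R := LimF α) (S := Unit)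
        (.const (nonempty_limF α).some) (.const ()) fun _ => rfl
      exact hu.congr hpow' (LimIso.hom_unit.trans limF_zero.symm)
    | add_one β _ =>
      have hβα : β ≤ α := Order.lt_add_one_iff.1 (Order.add_one_le_iff.1 hβ)
      -- The induction hypothesis `N⟨β⟩ × N⟨α⟩ ≅ N⟨α⟩` makes `N⟨β⟩` a retract of `N⟨α⟩`, by fixing
      -- the second coordinate.
      obtain ⟨e⟩ := ih hα' hβα
      let a := (nonempty_limF α).some
      have hr := Absorbs.nat_pow_of_retract (R := LimF α) (S := LimF β)
        ⟨fun x => e.hom (x, a), fun h => e.hom.map_conv ⟨h, conv_const a⟩⟩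
        ⟨fun x => (e.inv x).1, fun h => (e.inv.map_conv h).1⟩ fun x => by simp
      exact hr.congr hpow' (limF_add_one (hβα.trans_lt hα')).symm
    | limit β hβ' ihβ =>
      have := countable_toType (hβ.trans_lt hα)
      obtain ⟨f, hf⟩ := exists_injective_nat β.ToType
      -- Each factor of `N⟨β⟩` is absorbed by its own copy in the countable power of `N⟨α + 1⟩`.
      exact (Absorbs.pi_of_injective (B := fun _ : ℕ => LimF (α + 1)) f hf
        fun i => ihβ _ (toOrd_lt i) ((toOrd_lt i).le.trans hβ)).congr hpow.symm (limF_limit hβ').symm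
  | limit α hα' ih =>
    obtain rfl | hβ := hβ.eq_or_lt
    · exact (Absorbs.pi fun i : β.ToType => ih _ (toOrd_lt i) (toOrd_lt_omega_one hα i) le_rfl).congr
        (limF_limit hα').symm (limF_limit hα').symm
    · refine (Absorbs.pi_of_apply (B := fun i : α.ToType => LimF i.toOrd.1)
        (Ordinal.ToType.mk ⟨β, Set.mem_Iio.2 hβ⟩) ?_).congr (limF_limit hα').symm (.refl (LimF β))
      rw [toOrd_mk]
      exact ih β hβ (hβ.trans hα) le_rfl

theorem limF_pow {α : Ordinal.{0}} (hα : α < ω₁) (h0 : α ≠ 0) :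
    LimIso (LimF α) (ℕ → LimF α) := by
  induction α using Ordinal.limitRecOn with
  | zero => exact absurd rfl h0
  | add_one α _ =>
    have hα' : α < ω₁ := (lt_add_one α).trans hα
    exact limF_add_one_pow hα' (absorbs_limF hα' zero_le)
  | limit α hα' _ =>
    refine Absorbs.limIso (Absorbs.pi_of_apply 0 (absorbs_limF hα le_rfl)) ?_
    have hcomm : LimIso (ℕ → LimF α) (∀ i : α.ToType, ℕ → LimF i.toOrd.1) :=
      (LimIso.pi fun _ => limF_limit hα').trans LimIso.pi_comm
    -- The power `N⟨γ⟩ ^ ω` is absorbed by the factor `N⟨γ + 1⟩`, which is its own countable power;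
    -- `γ ↦ γ + 1` is injective below a limit.
    refine Absorbs.congr (limF_limit hα').symm hcomm.symm (Absorbs.pi_of_injective
      (fun i : α.ToType => Ordinal.ToType.mk ⟨i.toOrd.1 + 1,
        Set.mem_Iio.2 (hα'.add_one_lt (toOrd_lt i))⟩)
      (fun i j hij => ?_) fun i => ?_)
    · have := congrArg Subtype.val (Ordinal.ToType.mk.injective hij)
      exact Ordinal.ToType.mk.symm.injective (Subtype.ext (Order.succ_injective this))
    · have hi := toOrd_lt_omega_one hα i
      rw [toOrd_mk]
      exact (Absorbs.pi fun _ : ℕ => absorbs_limF (add_one_lt_omega_one hi)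
        (lt_add_one i.toOrd.1).le).congr
        (limF_add_one_pow hi (absorbs_limF hi zero_le)).symm (.refl _)

/-- The case `α = 0` must be excluded, since `ω` does not absorb the uncountable `ω ^ ω`. -/
theorem absorbs_limF_pi {ι : Type} [Countable ι] {a : ι → Ordinal.{0}} {α : Ordinal.{0}}
    (hα : α < ω₁) (h0 : α ≠ 0) (ha : ∀ i, a i ≤ α) : Absorbs (LimF α) (∀ i, LimF (a i)) := by
  obtain ⟨f, hf⟩ := exists_injective_nat ι
  exact (Absorbs.pi_of_injective (B := fun _ : ℕ => LimF α) f hf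
    fun i => absorbs_limF hα (ha i)).congr (limF_pow hα h0).symm (.refl _)

theorem exists_injective_of_infinite {ι κ : Type} [Countable ι] [Countable κ] (r : ι → κ → Prop)
    (h : ∀ i, {k | r i k}.Infinite) : ∃ f : ι → κ, f.Injective ∧ ∀ i, r i (f i) := by
  rcases isEmpty_or_nonempty ι with _ | ⟨⟨i₀⟩⟩
  · exact ⟨isEmptyElim, fun i => isEmptyElim i, isEmptyElim⟩
  have : Infinite κ := Set.infinite_univ_iff.1 ((h i₀).mono (Set.subset_univ _))
  obtain ⟨e⟩ : Nonempty (κ ≃ ℕ) := nonempty_equiv_of_countable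
  obtain ⟨c, hc⟩ := exists_injective_nat ι
  -- With both sides coded in `ℕ`, a strictly increasing choice of partners is automatically
  -- injective.
  obtain ⟨φ, hφ, hr⟩ := extraction_forall_of_frequently
    (P := fun n k => ∀ i, c i = n → r i (e.symm k)) fun n => by
      by_cases hn : ∃ i, c i = n
      · obtain ⟨i, rfl⟩ := hn
        have hinf := (h i).image e.injective.injOn
        refine (Nat.frequently_atTop_iff_infinite.2 hinf).mono ?_
        rintro _ ⟨k, hk, rfl⟩ j hj
        rw [hc hj, e.symm_apply_apply]
        exact hk
      · exact Frequently.of_forall fun k i hi => absurd ⟨i, hi⟩ hn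
  exact ⟨fun i => e.symm (φ (c i)), e.symm.injective.comp (hφ.injective.comp hc),
    fun i => hr _ i rfl⟩

theorem infinite_setOf_le {ι : Type} {a : ι → Ordinal.{0}} (ha : ∀ i, ∃ j, a i < a j)
    {γ : Ordinal.{0}} (hγ : ∃ i, γ ≤ a i) : {i | γ ≤ a i}.Infinite := fun hfin => by
  obtain ⟨i, hi, hmax⟩ := Set.exists_max_image _ a hfin hγ
  obtain ⟨j, hj⟩ := ha i
  exact (hmax j (le_trans hi hj.le)).not_gt hj

/-! ### Closure properties -/

/-- Being isomorphic to a member of `F`. -/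
def IsLimF (X : Type) [LimSpace X] : Prop := LimIso X Unit ∨ ∃ α < ω₁, LimIso X (LimF α)

variable {X Y : Type} [LimSpace X] [LimSpace Y]

theorem IsLimF.congr (h : IsLimF X) (e : LimIso Y X) : IsLimF Y :=
  h.imp e.trans fun ⟨α, hα, h⟩ => ⟨α, hα, e.trans h⟩

theorem isLimF_limF {α : Ordinal.{0}} (h : α < ω₁) : IsLimF (LimF α) := .inr ⟨α, h, .refl _⟩

theorem isLimF_of_F {X : TopCat.{0}} (h : F X) : IsLimF (Lim X) := by
  obtain rfl | ⟨α, hα, rfl⟩ := h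
  exacts [.inl limIso_punit, isLimF_limF hα]

theorem IsLimF.exists_F (h : IsLimF X) : ∃ P : TopCat.{0}, F P ∧ LimIso (Lim P) X := by
  obtain h | ⟨α, hα, h⟩ := h
  exacts [⟨_, .inl rfl, limIso_punit.trans h.symm⟩, ⟨_, .inr ⟨α, hα, rfl⟩, h.symm⟩]

theorem isLimF_pi_limF {ι : Type} [Countable ι] {a : ι → Ordinal.{0}} (ha : ∀ i, a i < ω₁) :
    IsLimF (∀ i, LimF (a i)) := by
  rcases isEmpty_or_nonempty ι with _ | hne
  · exact .inl .pi_isEmpty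
  by_cases hmax : ∃ i, ∀ j, a j ≤ a i
  · obtain ⟨i, hi⟩ := hmax
    by_cases h0 : a i = 0
    · have e : LimIso (∀ i, LimF (a i)) (ι → ℕ) := .pi fun j =>
        (le_antisymm ((hi j).trans h0.le) zero_le : a j = 0) ▸ limF_zero
      have hω : (0 : Ordinal.{0}) < ω₁ := zero_le.trans_lt (ha i)
      rcases finite_or_infinite ι with _ | _
      · exact .inr ⟨0, hω, e.trans (LimIso.pi_nat_finite.trans limF_zero.symm)⟩
      · obtain ⟨f⟩ : Nonempty (ℕ ≃ ι) := nonempty_equiv_of_countable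
        refine .inr ⟨0 + 1, add_one_lt_omega_one hω, e.trans ((LimIso.pi_reindex f).trans ?_)⟩
        exact LimIso.hom_of_discrete.symm.trans
          ((LimIso.hom limF_zero.symm (.refl ℕ)).trans (limF_add_one hω).symm)
    · exact .inr ⟨a i, ha i, Absorbs.limIso (absorbs_limF_pi (ha i) h0 hi)
        (Absorbs.pi_of_apply i (absorbs_limF (ha i) le_rfl))⟩
  · push Not at hmax
    -- An unattained supremum `s` is a limit ordinal. Infinitely many `a i` lie above each `γ < s`,
    -- and infinitely many `γ < s` above each `a i`, so injections in both directions give mutual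
    -- absorption of the product and `N⟨s⟩`.
    have hlt : ∀ i, a i < ⨆ i, a i := fun i =>
      (hmax i).elim fun j hj => hj.trans_le (Ordinal.le_iSup a j)
    have hsup : ∀ γ < ⨆ i, a i, ∃ i, γ < a i := fun γ => (Ordinal.lt_iSup_iff).1
    have hω : ⨆ i, a i < ω₁ := Ordinal.iSup_lt_omega_one ha
    generalize (⨆ i, a i) = s at hlt hsup hω
    have hs : Order.IsSuccLimit s := by
      refine Ordinal.isSuccLimit_iff.2 ⟨?_, fun b hb => ?_⟩
      · exact (zero_le.trans_lt (hlt hne.some)).ne'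
      · obtain ⟨i, hi⟩ := hsup b hb.lt
        exact hb.2 hi (hlt i)
    have := countable_toType hω
    obtain ⟨f, hf, hfr⟩ := exists_injective_of_infinite
      (fun (γ : s.ToType) (i : ι) => γ.toOrd.1 ≤ a i)
      fun γ => infinite_setOf_le hmax ((hsup _ (toOrd_lt γ)).imp fun _ h => h.le)
    have hinf : ∀ i, {γ : s.ToType | a i ≤ γ.toOrd.1}.Infinite := fun i =>
      infinite_setOf_le (a := fun γ : s.ToType => γ.toOrd.1)
        (fun γ => ⟨Ordinal.ToType.mk ⟨_, Set.mem_Iio.2 (hs.add_one_lt (toOrd_lt γ))⟩, by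
          rw [toOrd_mk]
          exact lt_add_one _⟩)
        ⟨Ordinal.ToType.mk ⟨_, Set.mem_Iio.2 (hlt i)⟩, (toOrd_mk _).ge⟩
    obtain ⟨g, hg, hgr⟩ := exists_injective_of_infinite
      (fun (i : ι) (γ : s.ToType) => a i ≤ γ.toOrd.1) hinf
    refine .inr ⟨s, hω, (Absorbs.limIso ?_ ?_).trans (limF_limit hs).symm⟩
    · exact Absorbs.pi_of_injective g hg fun i => absorbs_limF (toOrd_lt_omega_one hω _) (hgr i)
    · exact Absorbs.pi_of_injective f hf fun γ => absorbs_limF (ha _) (hfr γ)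

/-- One-point factors are split off first, leaving a product of spaces `N⟨a i⟩`. -/
theorem IsLimF.pi {ι : Type} [Countable ι] {A : ι → Type} [∀ i, LimSpace (A i)]
    (h : ∀ i, IsLimF (A i)) : IsLimF (∀ i, A i) := by
  have h1 : LimIso (∀ i : {i // LimIso (A i) Unit}, A i) Unit :=
    (LimIso.pi fun i => i.2).trans .pi_unit
  choose a ha e using fun i : {i // ¬LimIso (A i) Unit} => (h i).resolve_left i.2
  exact (isLimF_pi_limF ha).congr ((LimIso.pi_subtype _).trans
    ((h1.prod (.pi e)).trans .unit_prod))

theorem isLimF_hom_limF {α β : Ordinal.{0}} (hα : α < ω₁) (hβ : β < ω₁) :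
    IsLimF (LimHom (LimF β) (LimF α)) := by
  induction α using Ordinal.limitRecOn with
  | zero => exact .inr ⟨β + 1, add_one_lt_omega_one hβ,
      (LimIso.hom (.refl _) limF_zero).trans (limF_add_one hβ).symm⟩
  | add_one α _ =>
    have hα' : α < ω₁ := (lt_add_one α).trans hα
    have hm : max α β < ω₁ := max_lt hα' hβ
    have e : LimIso (LimF β × LimF α) (LimF (max α β)) := by
      rcases le_total α β with h | h
      · rw [max_eq_right h]
        exact LimIso.prod_comm.trans (absorbs_limF hβ h)
      · rw [max_eq_left h]
        exact absorbs_limF hα' h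
    exact .inr ⟨_, add_one_lt_omega_one hm, (LimIso.hom (.refl _) (limF_add_one hα')).trans
      (LimIso.hom_curry.symm.trans ((LimIso.hom e (.refl _)).trans (limF_add_one hm).symm))⟩
  | limit α hα' ih =>
    have := countable_toType hα
    exact (IsLimF.pi fun i : α.ToType => ih _ (toOrd_lt i) (toOrd_lt_omega_one hα i)).congr
      ((LimIso.hom (.refl _) (limF_limit hα')).trans .hom_pi)

theorem IsLimF.hom (hX : IsLimF X) (hY : IsLimF Y) : IsLimF (LimHom X Y) := by
  obtain hX | ⟨β, hβ, hX⟩ := hX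
  · exact hY.congr ((LimIso.hom hX (.refl Y)).trans .hom_unit)
  obtain hY | ⟨α, hα, hY⟩ := hY
  · exact .inl ((LimIso.hom (.refl X) hY).trans .unit_hom)
  · exact (isLimF_hom_limF hα hβ).congr (.hom hX hY)

theorem IsLimF.prod (hX : IsLimF X) (hY : IsLimF Y) : IsLimF (X × Y) := by
  obtain hX | ⟨α, hα, hX⟩ := hX
  · exact hY.congr ((hX.prod (.refl Y)).trans .unit_prod)
  obtain hY | ⟨β, hβ, hY⟩ := hY
  · exact .inr ⟨α, hα, ((LimIso.refl X).prod hY).trans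
      (LimIso.prod_comm.trans (LimIso.unit_prod.trans hX))⟩
  refine .inr ⟨max α β, max_lt hα hβ, (hX.prod hY).trans ?_⟩
  rcases le_total α β with h | h
  · rw [max_eq_right h]
    exact absorbs_limF hβ h
  · rw [max_eq_left h]
    exact LimIso.prod_comm.trans (absorbs_limF hα h)

end QCB

/-! ### From isomorphisms of convergence structures to categorical products and exponentials. -/

namespace QCB

open LimSpace MonoidalCategory CartesianMonoidalCategory

/-! ### Full subcategories of sequential spaces -/

variable {Q : ObjectProperty TopCat.{0}}

/-- The points and convergent sequences of an object of a full subcategory. -/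
abbrev Pts (X : Q.FullSubcategory) : Type := Lim X.obj

/-- The underlying map of a morphism. -/
def ptsMap {X Y : Q.FullSubcategory} (f : X ⟶ Y) : LimHom (Pts X) (Pts Y) :=
  limMap f.hom.hom f.hom.hom.continuous

theorem ptsMap_comp {X Y Z : Q.FullSubcategory} (f : X ⟶ Y) (g : Y ⟶ Z) (x : Pts X) :
    ptsMap (f ≫ g) x = ptsMap g (ptsMap f x) := rfl

theorem hom_ext_pts {X Y : Q.FullSubcategory} {f g : X ⟶ Y}
    (h : ∀ x : Pts X, ptsMap f x = ptsMap g x) : f = g :=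
  ObjectProperty.hom_ext _ (TopCat.hom_ext (ContinuousMap.ext h))

theorem hom_congr {X Y : Q.FullSubcategory} {f g : X ⟶ Y} (h : f = g) (x : X.obj) :
    f.hom.hom x = g.hom.hom x := by
  rw [h]

/-- The morphism given by a continuous map. -/
def homOfContinuous {X Y : Q.FullSubcategory} (f : X.obj → Y.obj) (hf : Continuous f) : X ⟶ Y :=
  ObjectProperty.homMk (TopCat.ofHom ⟨f, hf⟩)

/-- The morphism from a sequential space given by a map preserving convergent sequences. -/
def homOfPts {X Y : Q.FullSubcategory} (hX : SequentialSpace X.obj) (f : LimHom (Pts X) (Pts Y)) :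
    X ⟶ Y := homOfContinuous f f.continuous

theorem ptsMap_homOfPts {X Y : Q.FullSubcategory} (hX : SequentialSpace X.obj)
    (f : LimHom (Pts X) (Pts Y)) (x : Pts X) : ptsMap (homOfPts hX f) x = f x := rfl

/-- Between sequential spaces preserving convergent sequences is continuity, so the right convergent
sequences already give the universal property. -/
theorem exists_fan_isLimit (hQ : ∀ X : Q.FullSubcategory, SequentialSpace X.obj) {ι : Type}
    (X : ι → Q.FullSubcategory) (P : Q.FullSubcategory) (e : LimEquiv (Pts P) (∀ i, Pts (X i))) :
    ∃ c : Fan X, c.pt = P ∧ Nonempty (IsLimit c) := by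
  let c : Fan X := Fan.mk P fun i => homOfPts (hQ P) ⟨fun p => e.hom p i, fun h => e.map_conv h i⟩
  have hc : ∀ (i : ι) (p : Pts P), ptsMap (c.proj i) p = e.hom p i := fun _ _ => rfl
  refine ⟨c, rfl, ⟨Fan.IsLimit.mk _ (fun s => homOfPts (hQ _) (e.inv.comp
    ⟨fun x i => ptsMap (s.proj i) x, fun h i => (ptsMap (s.proj i)).map_conv h⟩)) ?_ ?_⟩⟩
  · intro s i
    refine hom_ext_pts fun x => ?_
    rw [ptsMap_comp, hc, ptsMap_homOfPts, LimHom.comp_apply, LimEquiv.hom_inv]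
    rfl
  · intro s m hm
    refine hom_ext_pts fun x => ?_
    rw [ptsMap_homOfPts, LimHom.comp_apply, ← e.inv_hom (ptsMap m x)]
    congr 1
    funext i
    rw [← hc, ← ptsMap_comp]
    exact hom_congr (hm i) x

/-- The binary product with prescribed points and convergent sequences. -/
def binaryLimitCone (hQ : ∀ X : Q.FullSubcategory, SequentialSpace X.obj)
    {X Y P : Q.FullSubcategory} (e : LimEquiv (Pts P) (Pts X × Pts Y)) : LimitCone (pair X Y) where
  cone := BinaryFan.mk (homOfPts (hQ P) ⟨fun p => (e.hom p).1, fun h => (e.map_conv h).1⟩)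
    (homOfPts (hQ P) ⟨fun p => (e.hom p).2, fun h => (e.map_conv h).2⟩)
  isLimit := BinaryFan.IsLimit.mk _
    (fun f g => homOfPts (hQ _) (e.inv.comp ⟨fun x => (ptsMap f x, ptsMap g x),
      fun h => ⟨(ptsMap f).map_conv h, (ptsMap g).map_conv h⟩⟩))
    (fun f g => hom_ext_pts fun x => by
      change (e.hom (e.inv _)).1 = _
      rw [LimEquiv.hom_inv]
      rfl)
    (fun f g => hom_ext_pts fun x => by
      change (e.hom (e.inv _)).2 = _
      rw [LimEquiv.hom_inv]
      rfl)
    (fun f g m hf hg => hom_ext_pts fun x => by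
      change _ = e.inv _
      rw [← e.inv_hom (ptsMap m x)]
      congr 1
      exact Prod.ext (hom_congr hf x) (hom_congr hg x))

/-- The terminal object with a single point. -/
def terminalLimitCone (hQ : ∀ X : Q.FullSubcategory, SequentialSpace X.obj)
    {P : Q.FullSubcategory} (e : LimEquiv (Pts P) Unit) :
    LimitCone (Functor.empty.{0} Q.FullSubcategory) where
  cone := asEmptyCone P
  isLimit := IsTerminal.ofUniqueHom (fun _ => homOfPts (hQ _) (.const (e.inv ())))
    fun _ _ => hom_ext_pts fun _ => e.toEquiv.injective rfl

/-- In a cartesian monoidal full subcategory, the points and convergent sequences of tensor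
products are those of the cartesian product. -/
def TensorIsProd (Q : ObjectProperty TopCat.{0}) [CartesianMonoidalCategory Q.FullSubcategory] :
    Prop :=
  ∀ X Y : Q.FullSubcategory, ∃ e : LimEquiv (Pts (X ⊗ Y)) (Pts X × Pts Y),
    ∀ t, e.hom t = (ptsMap (fst X Y) t, ptsMap (snd X Y) t)

namespace TensorIsProd

variable [CartesianMonoidalCategory Q.FullSubcategory] (hT : TensorIsProd Q)
  {X Y Y' : Q.FullSubcategory}

/-- The point of a tensor product with given coordinates. -/
noncomputable def pair (x : Pts X) (y : Pts Y) : Pts (X ⊗ Y) := (hT X Y).choose.inv (x, y)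

theorem pair_conv {u : ℕ → Pts X} {x : Pts X} {v : ℕ → Pts Y} {y : Pts Y} (hu : Conv u x)
    (hv : Conv v y) : Conv (fun n => hT.pair (u n) (v n)) (hT.pair x y) :=
  (hT X Y).choose.inv.map_conv ⟨hu, hv⟩

theorem pair_fst_snd (t : Pts (X ⊗ Y)) :
    hT.pair (ptsMap (fst X Y) t) (ptsMap (snd X Y) t) = t := by
  rw [pair, ← (hT X Y).choose_spec, LimEquiv.inv_hom]

theorem hom_pair (x : Pts X) (y : Pts Y) :
    (ptsMap (fst X Y) (hT.pair x y), ptsMap (snd X Y) (hT.pair x y)) = (x, y) := by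
  rw [← (hT X Y).choose_spec, pair, LimEquiv.hom_inv]

theorem fst_pair (x : Pts X) (y : Pts Y) : ptsMap (fst X Y) (hT.pair x y) = x :=
  congrArg Prod.fst (hT.hom_pair x y)

theorem snd_pair (x : Pts X) (y : Pts Y) : ptsMap (snd X Y) (hT.pair x y) = y :=
  congrArg Prod.snd (hT.hom_pair x y)

theorem whiskerLeft_pair (f : Y ⟶ Y') (x : Pts X) (y : Pts Y) :
    ptsMap (X ◁ f) (hT.pair x y) = hT.pair x (ptsMap f y) := by
  rw [← hT.pair_fst_snd (ptsMap (X ◁ f) (hT.pair x y)), ← ptsMap_comp, ← ptsMap_comp,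
    whiskerLeft_fst, whiskerLeft_snd, ptsMap_comp, fst_pair, snd_pair]

theorem tensor_hom_ext {Z : Q.FullSubcategory} {f g : X ⊗ Y ⟶ Z}
    (h : ∀ x y, ptsMap f (hT.pair x y) = ptsMap g (hT.pair x y)) : f = g :=
  hom_ext_pts fun t => by
    rw [← hT.pair_fst_snd t]
    exact h _ _

end TensorIsProd

/-- Continuous convergence is exactly what makes currying a bijection on sequence-preserving maps.
-/
theorem nonempty_monoidalClosed (hQ : ∀ X : Q.FullSubcategory, SequentialSpace X.obj)
    [CartesianMonoidalCategory Q.FullSubcategory] (hT : TensorIsProd Q)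
    (hE : ∀ X Y : Q.FullSubcategory, ∃ E : Q.FullSubcategory,
      LimIso (Pts E) (LimHom (Pts X) (Pts Y))) :
    Nonempty (MonoidalClosed Q.FullSubcategory) := by
  choose E ε using hE
  replace ε := fun X Y => (ε X Y).some
  let φ : ∀ X Z Y : Q.FullSubcategory, ((tensorLeft X).obj Z ⟶ Y) ≃ (Z ⟶ E X Y) := fun X Z Y =>
    { toFun := fun f => homOfPts (hQ Z) ⟨fun z => (ε X Y).inv
          ⟨fun x => ptsMap f (hT.pair x z),
            fun h => (ptsMap f).map_conv (hT.pair_conv h (conv_const z))⟩,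
        fun h => (ε X Y).inv.map_conv fun hu => (ptsMap f).map_conv (hT.pair_conv hu h)⟩
      invFun := fun g => homOfPts (hQ _)
        ⟨fun t => (ε X Y).hom (ptsMap g (ptsMap (snd X Z) t)) (ptsMap (fst X Z) t),
          fun h => (ε X Y).hom.map_conv ((ptsMap g).map_conv ((ptsMap (snd X Z)).map_conv h))
            ((ptsMap (fst X Z)).map_conv h)⟩
      left_inv := fun f => hom_ext_pts fun t => by
        simp only [ptsMap_homOfPts, LimHom.coe_mk, LimEquiv.hom_inv]
        rw [hT.pair_fst_snd]
      right_inv := fun g => hom_ext_pts fun z => by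
        simp only [ptsMap_homOfPts, LimHom.coe_mk]
        rw [← (ε X Y).inv_hom (ptsMap g z)]
        congr 1
        refine LimHom.ext_apply fun x => ?_
        simp only [LimHom.coe_mk, hT.fst_pair, hT.snd_pair] }
  refine ⟨⟨fun X => ⟨Adjunction.rightAdjointOfEquiv (φ X) ?_,
    Adjunction.adjunctionOfEquivRight (φ X) ?_⟩⟩⟩
  all_goals
    intro Z' Z Y f g
    refine hom_ext_pts fun z => ?_
    change (ε X Y).inv _ = (ε X Y).inv _
    congr 1
    refine LimHom.ext_apply fun x => ?_
    change ptsMap g (ptsMap (X ◁ f) _) = ptsMap g _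
    rw [hT.whiskerLeft_pair]
    rfl

/-! ### The category of the spaces of functionals -/

theorem F_sequential (X : F.FullSubcategory) : SequentialSpace X.obj :=
  (F_isSeqPseudobased X.property).sequential

theorem qcb0_sequential (X : QCB0) : SequentialSpace X.obj :=
  X.property.sequentialSpace

theorem F_closedUnderCountableProducts : ClosedUnderCountableProducts F := by
  intro ι _ X hX
  obtain ⟨P, hP, ⟨e⟩⟩ := (IsLimF.pi fun i => isLimF_of_F (hX i)).exists_F
  obtain ⟨c, hc, hlim⟩ := exists_fan_isLimit qcb0_sequential X ⟨P, F_le_isQCB0 P hP⟩ e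
  exact ⟨c, hc ▸ hP, hlim⟩

theorem F_isCartesianClosed : IsCartesianClosed F.FullSubcategory := by
  have hprod : ∀ X Y : F.FullSubcategory, ∃ P : F.FullSubcategory,
      LimIso (Pts P) (Pts X × Pts Y) := fun X Y =>
    let ⟨P, hP, e⟩ := ((isLimF_of_F X.property).prod (isLimF_of_F Y.property)).exists_F
    ⟨⟨P, hP⟩, e⟩
  choose P e using hprod
  let inst : CartesianMonoidalCategory F.FullSubcategory := .ofChosenFiniteProducts
    (terminalLimitCone F_sequential (P := ⟨_, .inl rfl⟩) limIso_punit.some)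
    (fun X Y => binaryLimitCone F_sequential (e X Y).some)
  refine ⟨inst, nonempty_monoidalClosed F_sequential (fun X Y => ⟨(e X Y).some, fun _ => rfl⟩) ?_⟩
  intro X Y
  obtain ⟨E, hE, e⟩ := ((isLimF_of_F X.property).hom (isLimF_of_F Y.property)).exists_F
  exact ⟨⟨E, hE⟩, e⟩

end QCB

/-! ### Minimality: testing universal properties on the Baire space. -/

namespace QCB

open LimSpace MonoidalCategory CartesianMonoidalCategory

/-! ### Detection of convergent sequences by the Baire space -/

section Baire

variable {X Y T : Type} [TopologicalSpace X] [TopologicalSpace Y] [TopologicalSpace T]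

theorem eventually_agree (p : ℕ → ℕ) (N : ℕ) : ∀ᶠ q in 𝓝 p, ∀ i ≤ N, q i = p i :=
  (Set.finite_le_nat N).eventually_all.2 fun i _ =>
    (continuous_apply i).continuousAt.eventually
      ((isOpen_discrete {p i}).mem_nhds (Set.mem_singleton _))

/-- Every convergent sequence is the image of a convergent sequence of the Baire space. -/
theorem exists_baire_tendsto {u : ℕ → Y} {y : Y} (hu : Tendsto u atTop (𝓝 y)) :
    ∃ (ψ : C(ℕ → ℕ, Y)) (p : ℕ → ℕ → ℕ) (q : ℕ → ℕ), Tendsto p atTop (𝓝 q) ∧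
      (∀ n, ψ (p n) = u n) ∧ ψ q = y := by
  classical
  -- The position of the first nonzero entry selects the term of the sequence, and the zero sequence
  -- goes to the limit; unit vectors then converge to `0` over `u`.
  let ψ : (ℕ → ℕ) → Y := fun p => if h : ∃ n, p n ≠ 0 then u (Nat.find h) else y
  have hψ : Continuous ψ := by
    refine continuous_iff_continuousAt.2 fun p => ?_
    by_cases h : ∃ n, p n ≠ 0
    · refine (continuousAt_const (y := ψ p)).congr ?_
      filter_upwards [eventually_agree p (Nat.find h)] with q hq
      have hq' : ∃ n, q n ≠ 0 := ⟨Nat.find h, by rw [hq _ le_rfl]; exact Nat.find_spec h⟩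
      have hfind : Nat.find hq' = Nat.find h := (Nat.find_eq_iff _).2
        ⟨by rw [hq _ le_rfl]; exact Nat.find_spec h, fun n hn => by
          rw [hq _ hn.le]; exact Nat.find_min h hn⟩
      simp only [ψ, dif_pos h, dif_pos hq', hfind]
    · refine tendsto_nhds.2 fun U hU hp => ?_
      have hy : y ∈ U := by
        have : ψ p ∈ U := hp
        simpa only [ψ, dif_neg h] using this
      obtain ⟨N, hN⟩ := eventually_atTop.1 (hu.eventually (hU.mem_nhds hy))
      filter_upwards [eventually_agree p N] with q hq
      change ψ q ∈ U
      by_cases h' : ∃ n, q n ≠ 0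
      · simp only [ψ, dif_pos h']
        refine hN _ (le_of_not_gt fun hlt => Nat.find_spec h' ?_)
        rw [hq _ hlt.le]
        exact not_not.1 fun h0 => h ⟨_, h0⟩
      · simpa only [ψ, dif_neg h'] using hy
  refine ⟨⟨ψ, hψ⟩, fun n => Pi.single n 1, 0, tendsto_pi_nhds.2 fun i => ?_, fun n => ?_, ?_⟩
  · refine tendsto_const_nhds.congr' ?_
    filter_upwards [eventually_gt_atTop i] with n hn
    simp [hn.ne]
  · have h : ∃ m, (Pi.single n 1 : ℕ → ℕ) m ≠ 0 := ⟨n, by simp⟩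
    have hfind : Nat.find h = n := (Nat.find_eq_iff _).2
      ⟨by simp, fun m hm => by simp [hm.ne]⟩
    change ψ _ = _
    simp only [ψ, dif_pos h, hfind]
  · change ψ 0 = y
    simp [ψ]

/-- A continuous map along which the continuous maps from the Baire space lift uniquely is a
bijection preserving and reflecting convergent sequences. -/
theorem exists_limEquiv_of_lift (e : T ≃ₜ (ℕ → ℕ)) (f : C(X, Y))
    (h : ∀ g : C(T, Y), ∃ k : C(T, X), ∀ t, f (k t) = g t)
    (hinj : ∀ k k' : C(T, X), (∀ t, f (k t) = f (k' t)) → k = k') :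
    ∃ φ : LimEquiv (Lim X) (Lim Y), ∀ x, φ.hom x = f x := by
  let t₀ : T := e.symm 0
  -- Constant maps from `T` represent points, so unique lifting gives bijectivity.
  have hf : Function.Bijective f := by
    refine ⟨fun x x' hx => ?_, fun y => ?_⟩
    · exact DFunLike.congr_fun (hinj (.const T x) (.const T x') fun _ => hx) t₀
    · obtain ⟨k, hk⟩ := h (.const T y)
      exact ⟨k t₀, hk t₀⟩
  refine ⟨⟨Equiv.ofBijective f hf, (limMap f f.continuous).map_conv, fun {u y} hu => ?_⟩,
    fun _ => rfl⟩
  obtain ⟨ψ, p, q, hpq, hp, hq⟩ := exists_baire_tendsto (Y := Y) (u := u) (y := y) hu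
  obtain ⟨k, hk⟩ := h (ψ.comp e)
  have hinv : ∀ (s : ℕ → ℕ), (Equiv.ofBijective f hf).symm (ψ s) = k (e.symm s) := fun s => by
    rw [Equiv.symm_apply_eq, Equiv.ofBijective_apply, hk]
    simp
  have hlim := ((k.continuous.comp e.symm.continuous).tendsto q).comp hpq
  change Tendsto (fun n => (Equiv.ofBijective f hf).symm (u n)) atTop
    (𝓝 ((Equiv.ofBijective f hf).symm y))
  simp only [← hp, ← hq, hinv]
  exact hlim

end Baire

/-- The Baire space as a qcb₀-space. -/
def baireQCB0 : QCB0 :=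
  ⟨TopCat.of (ℕ → ℕ), inferInstanceAs (T0Space (ℕ → ℕ)), TopCat.of (ℕ → ℕ),
    inferInstanceAs (SecondCountableTopology (ℕ → ℕ)), id, .id⟩

/-- Maps from the Baire space lift uniquely along the comparison with the Tychonoff product, by the
universal property. The Tychonoff product itself need not be an object of the category. -/
theorem limIso_of_isLimit {ι : Type} {X : ι → QCB0} (c : Fan X) (hc : IsLimit c) :
    LimIso (Pts c.pt) (∀ i, Pts (X i)) := by
  let f : C(c.pt.obj, ∀ i, (X i).obj) :=
    ⟨fun p i => (c.proj i).hom.hom p, continuous_pi fun i => (c.proj i).hom.hom.continuous⟩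
  obtain ⟨φ, -⟩ := exists_limEquiv_of_lift (Homeomorph.refl (ℕ → ℕ)) f
    (fun g => by
      let s : Fan X := Fan.mk baireQCB0 fun i =>
        homOfContinuous (X := baireQCB0) (fun t => g t i) ((continuous_apply i).comp g.continuous)
      refine ⟨(hc.lift s).hom.hom, fun t => funext fun i => ?_⟩
      exact hom_congr (hc.fac s ⟨i⟩) t)
    (fun k k' hk => by
      have : homOfContinuous (X := baireQCB0) k k.continuous =
          homOfContinuous (X := baireQCB0) (Y := c.pt) k' k'.continuous :=
        Fan.IsLimit.hom_ext hc _ _ fun i => hom_ext_pts fun t => congrFun (hk t) i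
      exact ContinuousMap.ext (hom_congr this))
  exact LimIso.trans ⟨φ⟩ (limIso_pi _)

variable {C : ObjectProperty TopCat.{0}}

/-- Convergence in a product space is coordinatewise. -/
def limEquivProd (X Y : Type) [TopologicalSpace X] [TopologicalSpace Y] :
    LimEquiv (Lim (X × Y)) (Lim X × Lim Y) :=
  ⟨Equiv.refl _, fun {u x} h => (@Prod.tendsto_iff X Y _ _ ℕ u atTop x).1 h,
    fun {u x} h => (@Prod.tendsto_iff X Y _ _ ℕ u atTop x).2 h⟩

theorem tensorIsProd_of_baire [CartesianMonoidalCategory C.FullSubcategory]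
    (T : C.FullSubcategory) (e : T.obj ≃ₜ (ℕ → ℕ)) : TensorIsProd C := by
  intro X Y
  let f : C((X ⊗ Y).obj, X.obj × Y.obj) :=
    ⟨fun t => ((fst X Y).hom.hom t, (snd X Y).hom.hom t),
      (fst X Y).hom.hom.continuous.prodMk (snd X Y).hom.hom.continuous⟩
  obtain ⟨φ, hφ⟩ := exists_limEquiv_of_lift e f
    (fun g => by
      let g₁ : T ⟶ X := homOfContinuous (fun t => (g t).1) (continuous_fst.comp g.continuous)
      let g₂ : T ⟶ Y := homOfContinuous (fun t => (g t).2) (continuous_snd.comp g.continuous)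
      refine ⟨(lift g₁ g₂).hom.hom, fun t => Prod.ext ?_ ?_⟩
      · exact hom_congr (lift_fst g₁ g₂) t
      · exact hom_congr (lift_snd g₁ g₂) t)
    (fun k k' hk => by
      have : homOfContinuous (X := T) k k.continuous =
          homOfContinuous (X := T) (Y := X ⊗ Y) k' k'.continuous :=
        CartesianMonoidalCategory.hom_ext _ _
          (hom_ext_pts fun t => congrArg Prod.fst (hk t))
          (hom_ext_pts fun t => congrArg Prod.snd (hk t))
      exact ContinuousMap.ext (hom_congr this))
  exact ⟨φ.trans (limEquivProd _ _), hφ⟩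

/-- The exponentials of a full cartesian closed subcategory containing the Baire space are
function spaces. -/
theorem limIso_ihom (hC : ∀ X : C.FullSubcategory, SequentialSpace X.obj)
    [CartesianMonoidalCategory C.FullSubcategory] [MonoidalClosed C.FullSubcategory]
    (T : C.FullSubcategory) (e : T.obj ≃ₜ (ℕ → ℕ)) (A B : C.FullSubcategory) [T2Space A.obj] :
    LimIso (Pts ((ihom A).obj B)) (LimHom (Pts A) (Pts B)) := by
  have := hC
  have hT := tensorIsProd_of_baire T e
  let ev := (ihom.ev A).app B
  have hev : ∀ {Z : C.FullSubcategory} (k : Z ⟶ (ihom A).obj B) (a : Pts A) (z : Pts Z),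
      ptsMap (MonoidalClosed.uncurry k) (hT.pair a z) = ptsMap ev (hT.pair a (ptsMap k z)) := by
    intro Z k a z
    rw [MonoidalClosed.uncurry_eq, ptsMap_comp, hT.whiskerLeft_pair]
  -- The comparison map is the transpose of evaluation. A map from `T` into the function space lifts
  -- along it by uncurrying on points, then currying in the category.
  let f : C(((ihom A).obj B).obj, C(A.obj, B.obj)) :=
    ⟨fun x => ⟨fun a => ptsMap ev (hT.pair a x), LimHom.continuous (X := A.obj) (Y := B.obj)
        ⟨fun a => ptsMap ev (hT.pair a x),
          fun h => (ptsMap ev).map_conv (hT.pair_conv h (conv_const (X := Pts _) x))⟩⟩,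
      SeqContinuous.continuous fun u x hu => tendsto_continuousMap_iff.2 fun v a hv =>
        (ptsMap ev).map_conv (hT.pair_conv hv hu)⟩
  obtain ⟨φ, -⟩ := exists_limEquiv_of_lift e f
    (fun g => by
      let G : A ⊗ T ⟶ B := homOfPts (hC _)
        ⟨fun t => g (ptsMap (snd A T) t) (ptsMap (fst A T) t), fun {u t} h =>
          tendsto_continuousMap_iff.1 ((g.continuous.tendsto _).comp
            (lim_conv_iff.1 ((ptsMap (snd A T)).map_conv h))) _ _
            (lim_conv_iff.1 ((ptsMap (fst A T)).map_conv h))⟩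
      have hG : ∀ a t, ptsMap G (hT.pair a t) = g t a := fun a t =>
        congrArg₂ (fun (s : T.obj) (b : A.obj) => g s b) (hT.snd_pair a t) (hT.fst_pair a t)
      refine ⟨(MonoidalClosed.curry G).hom.hom, fun t => ContinuousMap.ext fun a => ?_⟩
      refine (hev (MonoidalClosed.curry G) a t).symm.trans (Eq.trans ?_ (hG a t))
      rw [MonoidalClosed.uncurry_curry])
    (fun k k' hk => by
      have : homOfContinuous (X := T) k k.continuous =
          homOfContinuous (X := T) (Y := (ihom A).obj B) k' k'.continuous :=
        MonoidalClosed.uncurry_injective (hT.tensor_hom_ext fun a t => by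
          rw [hev, hev]
          exact DFunLike.congr_fun (hk t) a)
      exact ContinuousMap.ext (hom_congr this))
  exact LimIso.trans ⟨φ⟩ limIso_continuousMap

/-! ### Minimality -/

theorem LimIso.nonempty_homeomorph {X Y : Type} [TopologicalSpace X] [TopologicalSpace Y]
    [SequentialSpace X] [SequentialSpace Y] (h : LimIso (Lim X) (Lim Y)) : Nonempty (X ≃ₜ Y) :=
  h.map fun e => e.toHomeomorph

theorem ClosedUnderCountableProducts.exists_pi (hC : C ≤ IsQCB0)
    (hprod : ClosedUnderCountableProducts C) {ι : Type} [Countable ι] {X : ι → TopCat.{0}}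
    (hX : ∀ i, C (X i)) : ∃ P : TopCat.{0}, C P ∧ LimIso (Lim P) (∀ i, Lim (X i)) := by
  obtain ⟨c, hc, ⟨hlim⟩⟩ := hprod ι (fun i => ⟨X i, hC _ (hX i)⟩) hX
  exact ⟨c.pt.obj, hc, limIso_of_isLimit c hlim⟩

theorem exists_limIso_limF (hC : C ≤ IsQCB0) (hclosed : IsCartesianClosed C.FullSubcategory)
    (hprod : ClosedUnderCountableProducts C) (hω : C omegaSpace) {α : Ordinal.{0}} (hα : α < ω₁) :
    ∃ Y : TopCat.{0}, C Y ∧ LimIso (Lim Y) (LimF α) := by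
  obtain ⟨_, ⟨_⟩⟩ := hclosed
  have hseq : ∀ X : C.FullSubcategory, SequentialSpace X.obj := fun X =>
    (hC _ X.property).sequentialSpace
  induction α using Ordinal.limitRecOn with
  | zero => exact ⟨_, hω, limIso_of_eq functionals_zero.symm⟩
  | add_one α ih =>
    have hα' : α < ω₁ := (lt_add_one α).trans hα
    obtain ⟨A, hA, eA⟩ := ih hα'
    -- The countable power of `ω` supplies a copy of the Baire space inside `C`.
    obtain ⟨T, hT, eT⟩ := hprod.exists_pi hC fun _ : ℕ => hω
    have := (IsSeqPseudobased.functionals α hα').sequential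
    have := (IsSeqPseudobased.functionals α hα').t2
    have := hseq ⟨A, hA⟩
    have := hseq ⟨T, hT⟩
    -- Objects of `C` need not be Hausdorff; this one inherits the property from `N⟨α⟩`, as the
    -- description of the compact-open topology requires.
    have : T2Space A := eA.nonempty_homeomorph.some.symm.t2Space
    obtain ⟨e⟩ := (eT.trans (limIso_pi fun _ : ℕ => ℕ).symm).nonempty_homeomorph
    refine ⟨_, ((ihom (⟨A, hA⟩ : C.FullSubcategory)).obj ⟨_, hω⟩).property, ?_⟩
    exact (limIso_ihom hseq ⟨T, hT⟩ e ⟨A, hA⟩ ⟨_, hω⟩).trans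
      ((LimIso.hom eA limIso_nat).trans (limF_add_one hα').symm)
  | limit α hα' ih =>
    have := countable_toType hα
    choose Y hY e using fun i : α.ToType => ih _ (toOrd_lt i) (toOrd_lt_omega_one hα i)
    obtain ⟨P, hP, eP⟩ := hprod.exists_pi hC hY
    exact ⟨P, hP, eP.trans ((LimIso.pi e).trans (limF_limit hα').symm)⟩

theorem exists_limIso_of_F (hC : C ≤ IsQCB0) (hclosed : IsCartesianClosed C.FullSubcategory)
    (hprod : ClosedUnderCountableProducts C) (hω : C omegaSpace) {X : TopCat.{0}} (hX : F X) :
    ∃ Y : TopCat.{0}, C Y ∧ LimIso (Lim X) (Lim Y) := by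
  obtain rfl | ⟨α, hα, rfl⟩ := hX
  -- The one-point space arises as the empty product.
  · obtain ⟨P, hP, e⟩ := hprod.exists_pi hC (ι := Empty) (X := Empty.elim) (fun i => i.elim)
    exact ⟨P, hP, limIso_punit.trans (e.trans .pi_isEmpty).symm⟩
  · obtain ⟨Y, hY, e⟩ := exists_limIso_limF hC hclosed hprod hω hα
    exact ⟨Y, hY, e.symm⟩

end QCB

theorem theorem7p3 :
    (QCB.F ≤ QCB.IsQCB0 ∧
      QCB.IsCartesianClosed QCB.F.FullSubcategory ∧
      QCB.ClosedUnderCountableProducts QCB.F) ∧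
    ∀ C : CategoryTheory.ObjectProperty TopCat.{0},
      C ≤ QCB.IsQCB0 →
      QCB.IsCartesianClosed C.FullSubcategory →
      QCB.ClosedUnderCountableProducts C →
      C QCB.omegaSpace →
      ∀ X : TopCat.{0}, QCB.F X → ∃ Y : TopCat.{0}, C Y ∧ Nonempty (X ≃ₜ Y) := by
  refine ⟨⟨QCB.F_le_isQCB0, QCB.F_isCartesianClosed, QCB.F_closedUnderCountableProducts⟩, ?_⟩
  intro C hC hclosed hprod hω X hX
  obtain ⟨Y, hY, e⟩ := QCB.exists_limIso_of_F hC hclosed hprod hω hX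
  have := (QCB.F_isSeqPseudobased hX).sequential
  have := (hC Y hY).sequentialSpace
  exact ⟨Y, hY, e.nonempty_homeomorph⟩
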